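/- **Model.** There are $n\ge 1$ users and $K\ge1$ blocks; frames $t=0,1,2,\dots$ have duration $\Delta t>0$ and packets have size $\sigma>0$. The per-block rates $R_i(t)$ ($1\le i\le n$, $t\ge 0$) are independent over users and frames, take values in $\{r_1<\dots<r_m\}\subset(0,\infty)$, and $\mathbb P(R_i(t)=r_k)=p_{R_i}(r_k)$ does not depend on $t$. If user $i$ gets the fraction $Y_i(t)$ of frame $t$, her data rate is $C_i(t)=K\,Y_i(t)R_i(t)$ and $A_i(t)=\lfloor C_i(t)\Delta t/\sigma\rfloor$ packets arrive at her buffer, of size $B$. If $S$ packets are played out per frame ($0<S<B$; playout rate $U=S\sigma/\Delta t$), the buffer content obeys $Q_B(0)=0$, $Q_B(t+1)=\min\{B,\max\{S,Q_B(t)\}-S+A_i(t)\}$; for an infinite buffer, $Q(0)=0$, $Q(t+1)=\max\{S,Q(t)\}-S+A_i(t)$. Packets that find the buffer full are lost. The *outage* is $\lim_t\mathbb P(Q_B(t)<S)$, and the *drop rate* is the limit, as $T\to\infty$, of the expected number of packets lost divided by the expected number of packets arriving in the first $T$ frames. A playout rate is achievable for a user if these limits exist, the outage is at most $\varepsilon$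 and the drop rate is at most $\delta_0$. **Statement.** Let $Y_i(t)=\dfrac{1/R_i(t)}{\sum_{j=1}^n 1/R_j(t)}$. Then $0\le Y_i(t)\le 1$, $\sum_iY_i(t)=1$, and the following hold. 1. Every user receives the same rate: $C_i(t)=C(t)=K\big/\sum_{j=1}^n\frac1{R_j(t)}$. 2. With $\delta(0)=1$ and $\delta(y)=0$ for $y\neq0$, for every $x>0$ $$\mathbb P(C(t)=x)=p_C(x)=\sum_{k_1=1}^m\cdots\sum_{k_n=1}^m p_{R_1}(r_{k_1})\cdots p_{R_n}(r_{k_n})\,\delta\Big(\tfrac Kx-\tfrac1{r_{k_1}}-\dots-\tfrac1{r_{k_n}}\Big),$$ and $\mathbb P(C(t)=x)=0$ for $x\le0$. 3. For every integer $i\ge1$, $$\mathbb P\Big(\tfrac{C(t)\Delta t}{\sigma}=i\Big)=p_C\big(\tfrac{\sigma}{\Delta t} i\big)=\sum_{k_1=1}^m\cdots\sum_{k_n=1}^m p_{R_1}(r_{k_1})\cdots p_{R_n}(r_{k_n})\,\delta\Big(\tfrac{K\Delta t}{\sigma i}-\tfrac1{r_{k_1}}-\dots-\tfrac1{r_{k_n}}\Big).$$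 For each user the numbers $A_i(t)$, $t\ge0$, of whole packets arriving are i.i.d., with $$\mathbb P(A_i(t)=l)=p_A(l)=\sum_{k_1=1}^m\cdots\sum_{k_n=1}^m p_{R_1}(r_{k_1})\cdots p_{R_n}(r_{k_n})\,\mathbf 1\Big\{\Big\lfloor\tfrac{K\Delta t}{\sigma(1/r_{k_1}+\dots+1/r_{k_n})}\Big\rfloor=l\Big\}\qquad(l\ge0),$$ and mean $\mathbb E[A]=\sum_l l\,p_A(l)$. If $C(t)\Delta t/\sigma$ is almost surely an integer, then $p_A(0)=0$ and, for $l\ge1$, $p_A(l)$ equals the previous multi-sum at $i=l$. 4. Suppose $\mathbb E[A]>0$. For every integer $S$ with $0<S<B$ and $\mathbb E[A]<S$, the Markov chains of the finite and of the infinite buffer with arrival distribution $p_A$ have unique stationary distributions $(q_{i,B})_{0\le i\le B}$ and $(q_i)_{i\ge0}$. For every user they are the limits of $\mathbb P(Q_B(t)=i)$ and $\mathbb P(Q(t)=i)$; the outage is $\sum_{i=0}^{S-1}q_{i,B}$; and the drop rate is $$\frac{\sum_{i=0}^{S-1}(1-\frac iS)(q_{i,B}-q_i)}{1-\sum_{i=0}^{S-1}(1-\frac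 iS)q_i},$$ whose denominator is positive. Consequently, if some such $S$ satisfies the two constraints below, then $$U=\max\left\{\frac{S\sigma}{\Delta t}\ \middle|\ 0<S<B,\ \mathbb E[A]<S,\ \sum_{i=0}^{S-1}q_{i,B}\le\varepsilon,\ \frac{\sum_{i=0}^{S-1}(1-\frac iS)(q_{i,B}-q_i)}{1-\sum_{i=0}^{S-1}(1-\frac iS)q_i}\le\delta_0\right\}$$ exists. It is the highest playout rate among all $S\sigma/\Delta t$ with $0<S<B$ (whether or not $\mathbb E[A]<S$) that is achievable for user $i$, for each $i$, and the highest that is achievable for all users simultaneously. -/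

import Mathlib

open MeasureTheory ProbabilityTheory Filter Topology

noncomputable section

/-- Frame ratio inversely proportional to the per-block rate:
`Y_i(t) = (1 / R_i(t)) / ∑_j 1 / R_j(t)`. -/
def frameRatio {Ω : Type*} {n : ℕ} (R : Fin n → ℕ → Ω → ℝ) (i : Fin n) (t : ℕ) (ω : Ω) : ℝ :=
  (1 / R i t ω) / ∑ j, 1 / R j t ω

/-- Data rate `C_i(t) = K Y_i(t) R_i(t)` of user `i` in frame `t`. -/
def dataRate {Ω : Type*} {n : ℕ} (K : ℕ) (Y R : Fin n → ℕ → Ω → ℝ)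
    (i : Fin n) (t : ℕ) (ω : Ω) : ℝ :=
  K * Y i t ω * R i t ω

/-- The rate `C(t) = K / ∑_j 1 / R_j(t)`. -/
def commonRate {Ω : Type*} {n : ℕ} (K : ℕ) (R : Fin n → ℕ → Ω → ℝ) (t : ℕ) (ω : Ω) : ℝ :=
  K / ∑ j, 1 / R j t ω

/-- Number of (whole) packets of size `σ` that arrive in a frame of duration `Δ` at data rate
`C(t)`: `A(t) = ⌊C(t) Δ / σ⌋`. -/
def arrivals {Ω : Type*} (Δ σ : ℝ) (C : ℕ → Ω → ℝ) (t : ℕ) (ω : Ω) : ℕ :=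
  ⌊C t ω * Δ / σ⌋₊

/-- Packets arriving at user `i` when the frame is split by `frameRatio`. -/
def userArrivals {Ω : Type*} {n : ℕ} (K : ℕ) (Δ σ : ℝ) (R : Fin n → ℕ → Ω → ℝ) (i : Fin n) :
    ℕ → Ω → ℕ :=
  arrivals Δ σ (dataRate K (frameRatio R) R i)

/-- `∑_{k_1} ⋯ ∑_{k_n} p_{R_1}(r_{k_1}) ⋯ p_{R_n}(r_{k_n}) δ(K/x - 1/r_{k_1} - ⋯ - 1/r_{k_n})`,
where `p j l` is the probability that user `j` has per-block rate `r l`, and `δ` is the unit mass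
at `0`. -/
def ratePMF {n m : ℕ} (K : ℕ) (r : Fin m → ℝ) (p : Fin n → Fin m → ℝ) (x : ℝ) : ℝ :=
  ∑ k : Fin n → Fin m, (∏ j, p j (k j)) *
    (if (K : ℝ) / x - ∑ j, 1 / r (k j) = 0 then 1 else 0)

/-- `∑_{k_1} ⋯ ∑_{k_n} p_{R_1}(r_{k_1}) ⋯ p_{R_n}(r_{k_n}) δ(KΔ/(σi) - 1/r_{k_1} - ⋯ - 1/r_{k_n})`,
the probability that `C Δ / σ` is exactly `i`. -/
def exactArrivalPMF {n m : ℕ} (K : ℕ) (Δ σ : ℝ) (r : Fin m → ℝ) (p : Fin n → Fin m → ℝ)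
    (i : ℕ) : ℝ :=
  ∑ k : Fin n → Fin m, (∏ j, p j (k j)) *
    (if (K : ℝ) * Δ / (σ * i) - ∑ j, 1 / r (k j) = 0 then 1 else 0)

/-- The same multi-sum for the number of whole packets `⌊C Δ / σ⌋`. -/
def arrivalPMF {n m : ℕ} (K : ℕ) (Δ σ : ℝ) (r : Fin m → ℝ) (p : Fin n → Fin m → ℝ)
    (i : ℕ) : ℝ :=
  ∑ k : Fin n → Fin m, (∏ j, p j (k j)) *
    (if ⌊(K / ∑ j, 1 / r (k j)) * Δ / σ⌋₊ = i then 1 else 0)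

/-- Mean of a distribution on `ℕ`. -/
def pmfMean (a : ℕ → ℝ) : ℝ := ∑' i : ℕ, (i : ℝ) * a i

/-- Infinite buffer: `Q(0) = 0`, `Q(t+1) = max {S, Q(t)} - S + A(t)`. -/
def queue {Ω : Type*} (S : ℕ) (A : ℕ → Ω → ℕ) : ℕ → Ω → ℕ
  | 0, _ => 0
  | t + 1, ω => max S (queue S A t ω) - S + A t ω

/-- Buffer of size `B`: `Q_B(0) = 0`, `Q_B(t+1) = min {B, max {S, Q_B(t)} - S + A(t)}`. -/
def bufferQueue {Ω : Type*} (B S : ℕ) (A : ℕ → Ω → ℕ) : ℕ → Ω → ℕ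
  | 0, _ => 0
  | t + 1, ω => min B (max S (bufferQueue B S A t ω) - S + A t ω)

/-- Packets that arrive in frame `t` and find the buffer of size `B` full; the subtraction of `B`
is the positive part. -/
def lostPackets {Ω : Type*} (B S : ℕ) (A : ℕ → Ω → ℕ) (t : ℕ) (ω : Ω) : ℕ :=
  (max S (bufferQueue B S A t ω) - S + A t ω) - B

/-- The steady-state probability that fewer than `S` packets are in the buffer at the beginning
of a frame exists and is `e`. -/
def HasOutage {Ω : Type*} [MeasurableSpace Ω] (μ : Measure Ω) (B S : ℕ) (A : ℕ → Ω → ℕ)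
    (e : ℝ) : Prop :=
  Tendsto (fun t => μ.real {ω | bufferQueue B S A t ω < S}) atTop (𝓝 e)

/-- The long-run ratio of (expected) lost packets to (expected) arriving packets exists and
is `d`. -/
def HasDropRate {Ω : Type*} [MeasurableSpace Ω] (μ : Measure Ω) (B S : ℕ) (A : ℕ → Ω → ℕ)
    (d : ℝ) : Prop :=
  Tendsto (fun T : ℕ =>
    (∑ t ∈ Finset.range T, ∫ ω, (lostPackets B S A t ω : ℝ) ∂μ) /
      (∑ t ∈ Finset.range T, ∫ ω, (A t ω : ℝ) ∂μ)) atTop (𝓝 d)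

/-- Constant playout rates `S σ / Δ` (that is, `S` packets per frame, `0 < S < B`) at which a user
with arrivals `A` has outage at most `ε` and drop rate at most `δ₀`. -/
def achievableRates {Ω : Type*} [MeasurableSpace Ω] (μ : Measure Ω) (B : ℕ) (Δ σ ε δ₀ : ℝ)
    (A : ℕ → Ω → ℕ) : Set ℝ :=
  {u | ∃ S : ℕ, 0 < S ∧ S < B ∧ u = S * σ / Δ ∧
    (∃ e, HasOutage μ B S A e ∧ e ≤ ε) ∧ (∃ d, HasDropRate μ B S A d ∧ d ≤ δ₀)}

/-- Transition probability from `i` to `j` packets for the infinite buffer, with arrival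
distribution `a`. -/
def queueTrans (a : ℕ → ℝ) (S i j : ℕ) : ℝ :=
  if i ≤ S then a j else if j + S < i then 0 else a (j + S - i)

/-- Transition probability `ψ_{i,j}`, `0 ≤ i, j ≤ B`, for the buffer of size `B`. -/
def bufferTrans (a : ℕ → ℝ) (B S i j : ℕ) : ℝ :=
  if j < B then queueTrans a S i j else 1 - ∑ k ∈ Finset.range B, queueTrans a S i k

/-- `q` is a stationary distribution of the infinite-buffer chain. -/
structure IsQueueStationary (a : ℕ → ℝ) (S : ℕ) (q : ℕ → ℝ) : Prop where
  nonneg : ∀ i, 0 ≤ q i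
  hasSum_one : HasSum q 1
  balance : ∀ j, HasSum (fun i => q i * queueTrans a S i j) (q j)

/-- `q` (extended by zero beyond `B`) solves `q Ψ = q`, `∑ q_i = 1`, `q ≥ 0`. -/
structure IsBufferStationary (a : ℕ → ℝ) (B S : ℕ) (q : ℕ → ℝ) : Prop where
  nonneg : ∀ i, 0 ≤ q i
  zero_of_lt : ∀ i, B < i → q i = 0
  sum_one : ∑ i ∈ Finset.range (B + 1), q i = 1
  balance : ∀ j ≤ B, ∑ i ∈ Finset.range (B + 1), q i * bufferTrans a B S i j = q j

/-- `∑_{i<S} (1 - i/S)(q_{i,B} - q_i) / (1 - ∑_{i<S} (1 - i/S) q_i)`. -/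
def dropFormula (S : ℕ) (qB q : ℕ → ℝ) : ℝ :=
  (∑ i ∈ Finset.range S, (1 - (i : ℝ) / S) * (qB i - q i)) /
    (1 - ∑ i ∈ Finset.range S, (1 - (i : ℝ) / S) * q i)

/-- The set `{S σ / Δ | ∑_{i<S} q_{i,B} ≤ ε, dropFormula ≤ δ₀}` for the arrival distribution `a`,
where `0 < S < B` and `E[A] < S` (so that `q` exists). -/
def formulaRates (a : ℕ → ℝ) (B : ℕ) (Δ σ ε δ₀ : ℝ) : Set ℝ :=
  {u | ∃ S : ℕ, 0 < S ∧ S < B ∧ pmfMean a < S ∧ u = S * σ / Δ ∧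
    ∃ qB q : ℕ → ℝ, IsBufferStationary a B S qB ∧ IsQueueStationary a S q ∧
      ∑ i ∈ Finset.range S, qB i ≤ ε ∧ dropFormula S qB q ≤ δ₀}

end

/-! With ratios inversely proportional to the rates, `R i` cancels from the data rate, so all users
see the same function of the frame's rate vector. That vector has finitely many values and is
independent across frames. Hence the arrivals are bounded and i.i.d., and every law in question is a
finite sum over rate vectors (`measureReal_rate_event`).

Both buffers share the properties in `IsBufferUpdate`, and are studied through the operator
`stepOp`. Started empty, a monotone chain grows stochastically, so tail probabilities converge. For
`E[A] < S` a quadratic drift bounds the mean content, so no mass escapes and the limit is stationary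
(`exists_stationary_limit`). Conversely, two chains fed the same arrivals merge after a frame in
which the larger content is at most `S`; the waiting time for this has mean at most `i / (S - E[A])`
(`sum_survival_le`). Hence every stationary law is the limit from the empty buffer, which gives
uniqueness.

The drop rate is packet conservation. The mean loss in a frame is `E[A] - S + ∑_{k<S} (S - k) P(Q_B
= k)` plus a difference of consecutive mean contents, which tends to `0`. The infinite buffer loses
nothing, so `E[A] = S - ∑_{k<S} (S - k) q_k` (`stationary_throughput`); the quotient is
`dropFormula`. Finally, any `S ≤ E[A]` lies below every `S` admitted by the formula, so such rates
cannot exceed the maximum. -/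

/-! ### Buffer updates and the transition operator -/

/-- `a` is a probability distribution on `{0, …, N - 1}`. -/
structure IsFiniteLaw (a : ℕ → ℝ) (N : ℕ) : Prop where
  nonneg : ∀ l, 0 ≤ a l
  zero_of_le : ∀ l, N ≤ l → a l = 0
  sum_one : ∑ l ∈ Finset.range N, a l = 1

/-- A buffer update `φ (content) (arrivals)`: monotone in the content, not depending on the
content as long as at most `S` packets are there, and removing at most `S` packets. -/
structure IsBufferUpdate (S : ℕ) (φ : ℕ → ℕ → ℕ) : Prop where
  mono : ∀ l, Monotone fun i => φ i l
  flat : ∀ i l, i ≤ S → φ i l = φ 0 l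
  lower : ∀ i l, i ≤ φ i l + S
  upper : ∀ i l, φ i l ≤ max S i - S + l

/-- Update of the infinite buffer. -/
def queueUpdate (S i l : ℕ) : ℕ := max S i - S + l

/-- Update of the buffer of size `B`; contents above `B`, which do not occur, are only emptied at
rate `S`. -/
def bufferUpdate (B S i l : ℕ) : ℕ := min (max B (i - S)) (max S i - S + l)

lemma isBufferUpdate_queueUpdate (S : ℕ) : IsBufferUpdate S (queueUpdate S) where
  mono l i j h := by simp only [queueUpdate]; omega
  flat i l h := by simp only [queueUpdate]; omega
  lower i l := by simp only [queueUpdate]; omega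
  upper i l := le_rfl

/-- The cap `max B (i - S)` in place of `B` is what makes `lower` hold for every `i`, including the
unreachable `i > B + S`. -/
lemma isBufferUpdate_bufferUpdate (B S : ℕ) : IsBufferUpdate S (bufferUpdate B S) where
  mono l i j h := by simp only [bufferUpdate]; omega
  flat i l h := by simp only [bufferUpdate]; omega
  lower i l := by simp only [bufferUpdate]; omega
  upper i l := by simp only [bufferUpdate]; omega

lemma bufferUpdate_of_le {B i : ℕ} (S l : ℕ) (h : i ≤ B) :
    bufferUpdate B S i l = min B (max S i - S + l) := by
  simp only [bufferUpdate]; omega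

/-- The transition operator `f ↦ (i ↦ ∑_l a(l) f(φ(i, l)))`. -/
noncomputable def stepOp (a : ℕ → ℝ) (N : ℕ) (φ : ℕ → ℕ → ℕ) : Module.End ℝ (ℕ → ℝ) where
  toFun f i := ∑ l ∈ Finset.range N, a l * f (φ i l)
  map_add' f g := by ext i; simp [mul_add, Finset.sum_add_distrib]
  map_smul' c f := by
    ext i; simp only [Pi.smul_apply, smul_eq_mul, RingHom.id_apply, Finset.mul_sum]
    exact Finset.sum_congr rfl fun l _ => by ring

lemma stepOp_apply (a : ℕ → ℝ) (N : ℕ) (φ : ℕ → ℕ → ℕ) (f : ℕ → ℝ) (i : ℕ) :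
    stepOp a N φ f i = ∑ l ∈ Finset.range N, a l * f (φ i l) := rfl

lemma stepOp_pow_succ (a : ℕ → ℝ) (N : ℕ) (φ : ℕ → ℕ → ℕ) (t : ℕ) (f : ℕ → ℝ) :
    (stepOp a N φ ^ (t + 1)) f = stepOp a N φ ((stepOp a N φ ^ t) f) := by
  rw [pow_succ', Module.End.mul_apply]

lemma stepOp_pow_succ' (a : ℕ → ℝ) (N : ℕ) (φ : ℕ → ℕ → ℕ) (t : ℕ) (f : ℕ → ℝ) :
    (stepOp a N φ ^ (t + 1)) f = (stepOp a N φ ^ t) (stepOp a N φ f) := by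
  rw [pow_succ, Module.End.mul_apply]

/-- The indicator function of `{j}` on `ℕ`. -/
noncomputable def pointFun (j : ℕ) : ℕ → ℝ := fun i => if i = j then 1 else 0

/-- The indicator function of `{x, x + 1, …}`. -/
noncomputable def tailFun (x : ℕ) : ℕ → ℝ := fun i => if x ≤ i then 1 else 0

/-- The identity as a real-valued function. -/
noncomputable def idFun : ℕ → ℝ := fun i => i

/-! ### Drift, convergence and uniqueness of stationary laws -/

section Operator

variable {a : ℕ → ℝ} {N S : ℕ} {φ : ℕ → ℕ → ℕ}

lemma stepOp_mono (ha : IsFiniteLaw a N) {f g : ℕ → ℝ} (h : f ≤ g) :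
    stepOp a N φ f ≤ stepOp a N φ g := fun i => by
  simp only [stepOp_apply]
  exact Finset.sum_le_sum fun l _ => mul_le_mul_of_nonneg_left (h _) (ha.nonneg l)

lemma stepOp_pow_mono (ha : IsFiniteLaw a N) {f g : ℕ → ℝ} (h : f ≤ g) (t : ℕ) :
    (stepOp a N φ ^ t) f ≤ (stepOp a N φ ^ t) g := by
  induction t with
  | zero => simpa using h
  | succ t ih => simp only [stepOp_pow_succ]; exact stepOp_mono ha ih

lemma stepOp_const (ha : IsFiniteLaw a N) (c : ℝ) :
    stepOp a N φ (fun _ => c) = fun _ => c := by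
  ext i; rw [stepOp_apply, ← Finset.sum_mul, ha.sum_one, one_mul]

lemma stepOp_pow_const (ha : IsFiniteLaw a N) (c : ℝ) (t : ℕ) :
    (stepOp a N φ ^ t) (fun _ => c) = fun _ => c := by
  induction t with
  | zero => simp
  | succ t ih => rw [stepOp_pow_succ, ih, stepOp_const ha]

lemma stepOp_pow_nonneg (ha : IsFiniteLaw a N) {f : ℕ → ℝ} (h : ∀ i, 0 ≤ f i) (t i : ℕ) :
    0 ≤ (stepOp a N φ ^ t) f i := by
  have := stepOp_pow_mono (φ := φ) ha (f := fun _ => 0) (g := f) h t i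
  rwa [stepOp_pow_const ha] at this

lemma stepOp_pow_le_one (ha : IsFiniteLaw a N) {f : ℕ → ℝ} (h : ∀ i, f i ≤ 1) (t i : ℕ) :
    (stepOp a N φ ^ t) f i ≤ 1 := by
  have := stepOp_pow_mono (φ := φ) ha (f := f) (g := fun _ => 1) h t i
  rwa [stepOp_pow_const ha] at this

lemma monotone_stepOp_pow (ha : IsFiniteLaw a N) (hφ : IsBufferUpdate S φ) {f : ℕ → ℝ}
    (h : Monotone f) (t : ℕ) : Monotone ((stepOp a N φ ^ t) f) := by
  induction t with
  | zero => simpa using h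
  | succ t ih =>
    rw [stepOp_pow_succ]
    intro i j hij
    simp only [stepOp_apply]
    exact Finset.sum_le_sum fun l _ => mul_le_mul_of_nonneg_left (ih (hφ.mono l hij)) (ha.nonneg l)

/-- Started from the empty buffer, the content grows stochastically with time. -/
lemma monotone_time_stepOp_pow (ha : IsFiniteLaw a N) (hφ : IsBufferUpdate S φ) {f : ℕ → ℝ}
    (h : Monotone f) : Monotone fun t => (stepOp a N φ ^ t) f 0 := by
  refine monotone_nat_of_le_succ fun t => ?_
  rw [stepOp_pow_succ, stepOp_apply]
  calc (stepOp a N φ ^ t) f 0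
      = ∑ l ∈ Finset.range N, a l * (stepOp a N φ ^ t) f 0 := by
        rw [← Finset.sum_mul, ha.sum_one, one_mul]
    _ ≤ _ := Finset.sum_le_sum fun l _ =>
        mul_le_mul_of_nonneg_left (monotone_stepOp_pow ha hφ h t (Nat.zero_le _)) (ha.nonneg l)

lemma monotone_tailFun (x : ℕ) : Monotone (tailFun x) := fun i j h => by
  simp only [tailFun]; split_ifs <;> first | omega | norm_num

lemma monotone_idFun : Monotone idFun := fun i j h => by simpa [idFun] using h

lemma pointFun_eq_sub (j : ℕ) : pointFun j = tailFun j - tailFun (j + 1) := by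
  ext i; simp only [pointFun, tailFun, Pi.sub_apply]; split_ifs <;> first | omega | norm_num

/-- Quadratic drift inequality. -/
lemma stepOp_sq_le (ha : IsFiniteLaw a N) (hφ : IsBufferUpdate S φ)
    (hm : ∑ l ∈ Finset.range N, (l : ℝ) * a l ≤ S) :
    ∃ C : ℝ, 0 ≤ C ∧ stepOp a N φ (fun i => (i : ℝ) ^ 2) ≤
      (fun i : ℕ => (i : ℝ) ^ 2) + ((-2 * (S - ∑ l ∈ Finset.range N, (l : ℝ) * a l)) • idFun
        + fun _ => C) := by
  set m := ∑ l ∈ Finset.range N, (l : ℝ) * a l with hm'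
  set v := ∑ l ∈ Finset.range N, (l : ℝ) ^ 2 * a l with hv
  have hv0 : 0 ≤ v := Finset.sum_nonneg fun l _ => mul_nonneg (by positivity) (ha.nonneg l)
  have hm0 : 0 ≤ m := Finset.sum_nonneg fun l _ => mul_nonneg (by positivity) (ha.nonneg l)
  have hSm : 0 ≤ S * (S - m) := mul_nonneg (by positivity) (by linarith)
  -- For `i ≥ S`, expanding the square leaves at most `S² + v`. For `i ≤ S` the left side is at most
  -- `v`, and the last term pays for the negative drift term `-2(S - m)i`.
  refine ⟨(S : ℝ) ^ 2 + v + 2 * (S * (S - m)), by positivity, fun i => ?_⟩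
  set w : ℝ := ((max S i - S : ℕ) : ℝ) with hw
  have h1 : stepOp a N φ (fun i => (i : ℝ) ^ 2) i ≤ w ^ 2 + 2 * w * m + v := by
    rw [stepOp_apply]
    calc ∑ l ∈ Finset.range N, a l * ((φ i l : ℕ) : ℝ) ^ 2
        ≤ ∑ l ∈ Finset.range N, a l * (w + l) ^ 2 := Finset.sum_le_sum fun l _ => by
          refine mul_le_mul_of_nonneg_left (pow_le_pow_left₀ (by positivity) ?_ 2) (ha.nonneg l)
          rw [hw]; exact_mod_cast hφ.upper i l
      _ = ∑ l ∈ Finset.range N, (w ^ 2 * a l + 2 * w * ((l : ℝ) * a l) + (l : ℝ) ^ 2 * a l) :=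
          Finset.sum_congr rfl fun l _ => by ring
      _ = _ := by
          rw [Finset.sum_add_distrib, Finset.sum_add_distrib, ← Finset.mul_sum, ← Finset.mul_sum,
            ha.sum_one, mul_one]
  refine h1.trans ?_
  simp only [Pi.add_apply, Pi.smul_apply, smul_eq_mul, idFun]
  rcases le_total S i with h | h
  · have : w = i - S := by rw [hw, max_eq_right h, Nat.cast_sub h]
    rw [this]
    nlinarith [mul_nonneg (Nat.cast_nonneg S : (0:ℝ) ≤ S) hm0]
  · have : w = 0 := by rw [hw, max_eq_left h]; simp
    have h' : (i : ℝ) ≤ S := by exact_mod_cast h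
    rw [this]
    nlinarith [sq_nonneg (i : ℝ), mul_nonneg (sub_nonneg.2 h') (sub_nonneg.2 hm), sq_nonneg (S : ℝ)]

/-- The mean content stays bounded. -/
lemma exists_mean_bound (ha : IsFiniteLaw a N) (hφ : IsBufferUpdate S φ)
    (hm : ∑ l ∈ Finset.range N, (l : ℝ) * a l < S) :
    ∃ C : ℝ, ∀ t, (stepOp a N φ ^ t) idFun 0 ≤ C := by
  obtain ⟨C, hC0, hC⟩ := stepOp_sq_le ha hφ hm.le
  set c := (S : ℝ) - ∑ l ∈ Finset.range N, (l : ℝ) * a l with hc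
  have hc0 : 0 < c := by rw [hc]; linarith
  set V : ℕ → ℝ := fun i => (i : ℝ) ^ 2
  set M : ℕ → ℝ := fun t => (stepOp a N φ ^ t) idFun 0 with hM
  have hstep : ∀ t, (stepOp a N φ ^ (t + 1)) V 0 ≤ (stepOp a N φ ^ t) V 0 - 2 * c * M t + C := by
    intro t
    rw [stepOp_pow_succ']
    refine (stepOp_pow_mono ha hC t 0).trans_eq ?_
    rw [map_add, map_add, map_smul, stepOp_pow_const ha]
    simp only [Pi.add_apply, Pi.smul_apply, smul_eq_mul, hM]; ring
  -- Telescoping the drift bounds the time average of the means.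
  have hsum : ∀ t, (stepOp a N φ ^ t) V 0 + 2 * c * ∑ s ∈ Finset.range t, M s ≤ C * t := by
    intro t
    induction t with
    | zero => simp [V]
    | succ t ih => rw [Finset.sum_range_succ]; push_cast; nlinarith [hstep t]
  have hmono : Monotone M := monotone_time_stepOp_pow ha hφ monotone_idFun
  have hM0 : ∀ t, 0 ≤ M t := fun t => stepOp_pow_nonneg ha (fun i => Nat.cast_nonneg i) t 0
  refine ⟨C / c, fun t => ?_⟩
  rcases Nat.eq_zero_or_pos t with rfl | ht
  · simpa [idFun] using div_nonneg hC0 hc0.le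
  -- Monotonicity in time turns the averaged bound into a pointwise one: `M t` is below each of the
  -- `t` means in the second half of the window.
  have h1 : (t : ℝ) * M t ≤ ∑ s ∈ Finset.range (t + t), M s := by
    rw [Finset.sum_range_add]
    have h2 : (t : ℝ) * M t ≤ ∑ s ∈ Finset.range t, M (t + s) := by
      simpa using Finset.card_nsmul_le_sum (Finset.range t) (fun s => M (t + s)) (M t)
        fun s _ => hmono (Nat.le_add_right t s)
    linarith [Finset.sum_nonneg fun s (_ : s ∈ Finset.range t) => hM0 s]
  have h3 := hsum (t + t)
  have h4 : 0 ≤ (stepOp a N φ ^ (t + t)) V 0 := stepOp_pow_nonneg ha (fun i => sq_nonneg _) _ 0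
  push_cast at h3
  have ht' : (0 : ℝ) < t := by exact_mod_cast ht
  rw [le_div_iff₀ hc0]
  have : (t : ℝ) * (M t * c) ≤ t * C := by nlinarith
  exact le_of_mul_le_mul_left this ht'

/-- A function with finite support is a combination of indicators of points. -/
lemma eq_sum_pointFun {f : ℕ → ℝ} {M : ℕ} (h : ∀ i, M ≤ i → f i = 0) :
    f = ∑ j ∈ Finset.range M, f j • pointFun j := by
  ext i
  simp only [Finset.sum_apply, Pi.smul_apply, smul_eq_mul, pointFun, mul_ite, mul_one, mul_zero,
    Finset.sum_ite_eq, Finset.mem_range]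
  split_ifs with hi
  · rfl
  · exact h i (not_lt.1 hi)

/-- At most `S` packets leave per frame, so a large content stays outside the support. This keeps
later exchanges of limits and sums finite. -/
lemma stepOp_finite_support (hφ : IsBufferUpdate S φ) {f : ℕ → ℝ} {M : ℕ}
    (h : ∀ i, M ≤ i → f i = 0) (i : ℕ) (hi : M + S ≤ i) : stepOp a N φ f i = 0 := by
  rw [stepOp_apply]
  refine Finset.sum_eq_zero fun l _ => ?_
  rw [h _ (by have := hφ.lower i l; omega), mul_zero]

lemma stepOp_pow_finite_support (hφ : IsBufferUpdate S φ) {f : ℕ → ℝ} {M : ℕ}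
    (h : ∀ i, M ≤ i → f i = 0) (t : ℕ) : ∀ i, M + t * S ≤ i → (stepOp a N φ ^ t) f i = 0 := by
  induction t with
  | zero => simpa using h
  | succ t ih =>
    intro i hi
    rw [stepOp_pow_succ]
    exact stepOp_finite_support hφ ih i (by rw [add_mul] at hi; omega)

lemma pointFun_eq_zero (j i : ℕ) (h : j + 1 ≤ i) : pointFun j i = 0 := by
  simp only [pointFun]; rw [if_neg (by omega)]

/-- `q` is a stationary distribution of the chain with transition operator `stepOp a N φ`. -/
structure IsStationaryLaw (a : ℕ → ℝ) (N : ℕ) (φ : ℕ → ℕ → ℕ) (q : ℕ → ℝ) : Prop where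
  nonneg : ∀ i, 0 ≤ q i
  hasSum_one : HasSum q 1
  balance : ∀ j, HasSum (fun i => q i * stepOp a N φ (pointFun j) i) (q j)

/-- Limits of the laws of the content exist and form a stationary distribution. -/
lemma exists_stationary_limit (ha : IsFiniteLaw a N) (hφ : IsBufferUpdate S φ)
    (hm : ∑ l ∈ Finset.range N, (l : ℝ) * a l < S) :
    ∃ q, IsStationaryLaw a N φ q ∧
      ∀ j, Tendsto (fun t => (stepOp a N φ ^ t) (pointFun j) 0) atTop (𝓝 (q j)) := by
  obtain ⟨C, hC⟩ := exists_mean_bound ha hφ hm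
  have h01 : ∀ x i, tailFun x i ≤ 1 := fun x i => by simp only [tailFun]; split_ifs <;> norm_num
  have h00 : ∀ x i, 0 ≤ tailFun x i := fun x i => by simp only [tailFun]; split_ifs <;> norm_num
  have hlim : ∀ x, ∃ H, Tendsto (fun t => (stepOp a N φ ^ t) (tailFun x) 0) atTop (𝓝 H) :=
    fun x => ⟨_, tendsto_atTop_ciSup (monotone_time_stepOp_pow ha hφ (monotone_tailFun x))
      ⟨1, by rintro _ ⟨t, rfl⟩; exact stepOp_pow_le_one ha (h01 x) t 0⟩⟩
  choose H hH using hlim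
  have hq : ∀ j, Tendsto (fun t => (stepOp a N φ ^ t) (pointFun j) 0) atTop
      (𝓝 (H j - H (j + 1))) := fun j => by
    simp only [pointFun_eq_sub, map_sub, Pi.sub_apply]
    exact (hH j).sub (hH (j + 1))
  have hH0 : H 0 = 1 := by
    refine tendsto_nhds_unique (hH 0) ?_
    have : tailFun 0 = fun _ => 1 := by ext i; simp [tailFun]
    simp [this, stepOp_pow_const ha]
  -- Tightness: Markov's inequality with the uniform mean bound gives `H x ≤ C / x`.
  have hHlim : Tendsto H atTop (𝓝 0) := by
    refine tendsto_of_tendsto_of_tendsto_of_le_of_le' tendsto_const_nhds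
      (tendsto_const_div_atTop_nhds_zero_nat C) (.of_forall fun x => ?_) ?_
    · exact ge_of_tendsto' (hH x) fun t => stepOp_pow_nonneg ha (h00 x) t 0
    · filter_upwards [eventually_gt_atTop 0] with x hx
      refine le_of_tendsto' (hH x) fun t => ?_
      have hx' : (0 : ℝ) < x := by exact_mod_cast hx
      rw [le_div_iff₀ hx']
      have : (x : ℝ) • tailFun x ≤ idFun := fun i => by
        simp only [Pi.smul_apply, smul_eq_mul, tailFun, idFun]
        split_ifs with h
        · simpa using h
        · simp
      have := stepOp_pow_mono (φ := φ) ha this t 0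
      rw [map_smul, Pi.smul_apply, smul_eq_mul] at this
      linarith [hC t]
  have hnn : ∀ j, 0 ≤ H j - H (j + 1) := fun j => ge_of_tendsto' (hq j) fun t =>
    stepOp_pow_nonneg ha (fun i => by simp only [pointFun]; split_ifs <;> norm_num) t 0
  refine ⟨fun j => H j - H (j + 1), ⟨hnn, ?_, fun j => ?_⟩, hq⟩
  · rw [hasSum_iff_tendsto_nat_of_nonneg hnn]
    simp only [Finset.sum_range_sub', hH0]
    simpa using hHlim.const_sub 1
  -- Balance at `j` involves only finitely many predecessors, so it follows by computing the limit
  -- at time `t + 1` in two ways.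
  · have hs : ∀ i, j + 1 + S ≤ i → stepOp a N φ (pointFun j) i = 0 :=
      stepOp_finite_support hφ (pointFun_eq_zero j)
    have h1 := (hq j).comp (tendsto_add_atTop_nat 1)
    have h2 : Tendsto (fun t => (stepOp a N φ ^ (t + 1)) (pointFun j) 0) atTop
        (𝓝 (∑ i ∈ Finset.range (j + 1 + S), stepOp a N φ (pointFun j) i * (H i - H (i + 1)))) := by
      simp only [stepOp_pow_succ']
      have h3 : ∀ t, (stepOp a N φ ^ t) (stepOp a N φ (pointFun j)) 0
          = ∑ i ∈ Finset.range (j + 1 + S),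
            stepOp a N φ (pointFun j) i * (stepOp a N φ ^ t) (pointFun i) 0 := fun t => by
        conv_lhs => rw [eq_sum_pointFun hs]
        simp only [map_sum, map_smul, Finset.sum_apply, Pi.smul_apply, smul_eq_mul]
      simp only [h3]
      exact tendsto_finsetSum _ fun i _ => (hq i).const_mul _
    have h3 := tendsto_nhds_unique h1 h2
    simp only [mul_comm] at h3 ⊢
    rw [h3]
    refine hasSum_sum_of_ne_finset_zero fun i hi => ?_
    rw [hs i (by simpa using hi), mul_zero]

/-- Expectation of the first-passage functional: probability that the content has not been at most
`S` before time `t`. -/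
noncomputable def survival (a : ℕ → ℝ) (N S : ℕ) (φ : ℕ → ℕ → ℕ) : ℕ → ℕ → ℝ
  | 0, _ => 1
  | t + 1, i => if i ≤ S then 0 else stepOp a N φ (survival a N S φ t) i

lemma survival_nonneg (ha : IsFiniteLaw a N) (t i : ℕ) : 0 ≤ survival a N S φ t i := by
  induction t generalizing i with
  | zero => simp [survival]
  | succ t ih =>
    simp only [survival]
    split_ifs
    · exact le_rfl
    · rw [stepOp_apply]
      exact Finset.sum_nonneg fun l _ => mul_nonneg (ha.nonneg l) (ih _)

/-- Above `S` the content loses on average at least `S - E[A]` per frame, so `i / (S - E[A])`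
dominates the mean passage time; the induction is first-step analysis. -/
lemma sum_survival_le (ha : IsFiniteLaw a N) (hφ : IsBufferUpdate S φ)
    (hm : ∑ l ∈ Finset.range N, (l : ℝ) * a l < S) (t i : ℕ) :
    ∑ s ∈ Finset.range t, survival a N S φ (s + 1) i
      ≤ i / (S - ∑ l ∈ Finset.range N, (l : ℝ) * a l) := by
  set c := (S : ℝ) - ∑ l ∈ Finset.range N, (l : ℝ) * a l with hc
  have hc0 : 0 < c := by rw [hc]; linarith
  induction t generalizing i with
  | zero => simpa using div_nonneg (Nat.cast_nonneg i) hc0.le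
  | succ t ih =>
    by_cases hi : i ≤ S
    · simpa [survival, hi] using div_nonneg (Nat.cast_nonneg i) hc0.le
    · have h1 : ∀ s, survival a N S φ (s + 1) i = stepOp a N φ (survival a N S φ s) i :=
        fun s => by simp [survival, hi]
      have h0 : survival a N S φ 0 = fun _ => 1 := by ext; simp [survival]
      rw [Finset.sum_range_succ', h1 0, h0, stepOp_const ha]
      simp only [h1 (_ + 1), stepOp_apply]
      rw [Finset.sum_comm]
      simp only [← Finset.mul_sum]
      have h2 : ∑ l ∈ Finset.range N, a l * ∑ s ∈ Finset.range t, survival a N S φ (s + 1) (φ i l)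
          ≤ ∑ l ∈ Finset.range N, a l * (((i : ℝ) - S + l) / c) := by
        refine Finset.sum_le_sum fun l _ => mul_le_mul_of_nonneg_left ((ih _).trans ?_) (ha.nonneg l)
        refine div_le_div_of_nonneg_right ?_ hc0.le
        have := hφ.upper i l
        rw [max_eq_right (by omega)] at this
        have h3 : ((φ i l : ℕ) : ℝ) ≤ ((i - S + l : ℕ) : ℝ) := by exact_mod_cast this
        rwa [Nat.cast_add, Nat.cast_sub (by omega)] at h3
      have h4 : ∑ l ∈ Finset.range N, a l * (((i : ℝ) - S + l) / c) = (i - c) / c := by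
        have : ∀ l ∈ Finset.range N, a l * (((i : ℝ) - S + l) / c)
            = (i - S) / c * a l + ((l : ℝ) * a l) / c := fun l _ => by ring
        rw [Finset.sum_congr rfl this, Finset.sum_add_distrib, ← Finset.mul_sum, ha.sum_one,
          ← Finset.sum_div, hc]
        ring
      have h5 : ((i : ℝ) - c) / c + 1 = i / c := by field_simp; ring
      linarith

lemma tendsto_survival (ha : IsFiniteLaw a N) (hφ : IsBufferUpdate S φ)
    (hm : ∑ l ∈ Finset.range N, (l : ℝ) * a l < S) (i : ℕ) :
    Tendsto (fun t => survival a N S φ t i) atTop (𝓝 0) := by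
  rw [← tendsto_add_atTop_iff_nat 1]
  exact (summable_of_sum_range_le (fun s => survival_nonneg ha (s + 1) i)
    (fun t => sum_survival_le ha hφ hm t i)).tendsto_atTop_zero

/-- Chains with the same arrivals agree after both contents have been at most `S`. -/
lemma abs_stepOp_pow_sub_le (ha : IsFiniteLaw a N) (hφ : IsBufferUpdate S φ) {f : ℕ → ℝ}
    (hf : ∀ i, 0 ≤ f i ∧ f i ≤ 1) (t : ℕ) {i j : ℕ} (hij : j ≤ i) :
    |(stepOp a N φ ^ t) f i - (stepOp a N φ ^ t) f j| ≤ survival a N S φ t i := by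
  induction t generalizing i j with
  | zero =>
    simp only [pow_zero, Module.End.one_apply, survival]
    rw [abs_le]; constructor <;> linarith [(hf i).1, (hf i).2, (hf j).1, (hf j).2]
  | succ t ih =>
    simp only [stepOp_pow_succ, stepOp_apply, survival, ← Finset.sum_sub_distrib, ← mul_sub]
    split_ifs with hi
    -- When the larger content is at most `S`, so is the smaller, and both updates coincide.
    · refine le_of_eq ?_
      rw [abs_eq_zero]
      refine Finset.sum_eq_zero fun l _ => ?_
      rw [hφ.flat i l hi, hφ.flat j l (hij.trans hi), sub_self, mul_zero]
    · refine (Finset.abs_sum_le_sum_abs _ _).trans (Finset.sum_le_sum fun l _ => ?_)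
      rw [abs_mul, abs_of_nonneg (ha.nonneg l)]
      exact mul_le_mul_of_nonneg_left (ih (hφ.mono l hij)) (ha.nonneg l)

/-- Balance at points extends by linearity to finitely supported functions. -/
lemma IsStationaryLaw.hasSum_stepOp {q : ℕ → ℝ} (hq : IsStationaryLaw a N φ q) {f : ℕ → ℝ} {M : ℕ}
    (h : ∀ i, M ≤ i → f i = 0) :
    HasSum (fun i => q i * stepOp a N φ f i) (∑' i, q i * f i) := by
  rw [tsum_eq_sum (s := Finset.range M) fun i hi => by rw [h i (by simpa using hi), mul_zero]]
  have h1 := hasSum_sum fun j (_ : j ∈ Finset.range M) => (hq.balance j).mul_left (f j)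
  have h2 : ∀ i, q i * stepOp a N φ f i
      = ∑ j ∈ Finset.range M, f j * (q i * stepOp a N φ (pointFun j) i) := fun i => by
    conv_lhs => rw [eq_sum_pointFun h]
    simp only [map_sum, map_smul, Finset.sum_apply, Pi.smul_apply, smul_eq_mul, Finset.mul_sum]
    exact Finset.sum_congr rfl fun j _ => by ring
  simp only [h2]
  simpa only [mul_comm (q _) (f _)] using h1

lemma IsStationaryLaw.tsum_stepOp_pow (hφ : IsBufferUpdate S φ) {q : ℕ → ℝ}
    (hq : IsStationaryLaw a N φ q) {f : ℕ → ℝ} {M : ℕ} (h : ∀ i, M ≤ i → f i = 0) (t : ℕ) :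
    ∑' i, q i * (stepOp a N φ ^ t) f i = ∑' i, q i * f i := by
  induction t with
  | zero => simp
  | succ t ih =>
    rw [stepOp_pow_succ, (hq.hasSum_stepOp (stepOp_pow_finite_support hφ h t)).tsum_eq, ih]

/-- Every stationary distribution is the limit of the laws of the content. -/
lemma IsStationaryLaw.tendsto (ha : IsFiniteLaw a N) (hφ : IsBufferUpdate S φ)
    (hm : ∑ l ∈ Finset.range N, (l : ℝ) * a l < S) {q : ℕ → ℝ}
    (hq : IsStationaryLaw a N φ q) (j : ℕ) :
    Tendsto (fun t => (stepOp a N φ ^ t) (pointFun j) 0) atTop (𝓝 (q j)) := by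
  have hf : ∀ i, 0 ≤ pointFun j i ∧ pointFun j i ≤ 1 := fun i => by
    simp only [pointFun]; split_ifs <;> norm_num
  -- Averaging the initial content over `q`: each term vanishes by coupling with the empty start,
  -- and `q` itself dominates.
  have h1 : Tendsto (fun t => ∑' i, q i * ((stepOp a N φ ^ t) (pointFun j) i
      - (stepOp a N φ ^ t) (pointFun j) 0)) atTop (𝓝 (∑' _ : ℕ, (0 : ℝ))) := by
    refine tendsto_tsum_of_dominated_convergence (bound := q) hq.hasSum_one.summable (fun i => ?_)
      (.of_forall fun t i => ?_)
    · have h2 : Tendsto (fun t => (stepOp a N φ ^ t) (pointFun j) i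
          - (stepOp a N φ ^ t) (pointFun j) 0) atTop (𝓝 0) :=
        squeeze_zero_norm (fun t => abs_stepOp_pow_sub_le ha hφ hf t (Nat.zero_le i))
          (tendsto_survival ha hφ hm i)
      simpa using h2.const_mul (q i)
    · rw [norm_mul, Real.norm_of_nonneg (hq.nonneg i)]
      refine mul_le_of_le_one_right (hq.nonneg i) ?_
      rw [Real.norm_eq_abs, abs_le]
      have h0 := fun k => stepOp_pow_nonneg (φ := φ) ha (fun i => (hf i).1) t k
      have h1 := fun k => stepOp_pow_le_one (φ := φ) ha (fun i => (hf i).2) t k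
      constructor <;> linarith [h0 i, h0 0, h1 i, h1 0]
  have h3 : ∀ t, ∑' i, q i * ((stepOp a N φ ^ t) (pointFun j) i
      - (stepOp a N φ ^ t) (pointFun j) 0) = q j - (stepOp a N φ ^ t) (pointFun j) 0 := fun t => by
    have hs : Summable fun i => q i * (stepOp a N φ ^ t) (pointFun j) i :=
      summable_of_ne_finset_zero (s := Finset.range (j + 1 + t * S)) fun i hi => by
        rw [stepOp_pow_finite_support hφ (pointFun_eq_zero j) t i (by simpa using hi), mul_zero]
    simp only [mul_sub]
    rw [hs.tsum_sub (hq.hasSum_one.summable.mul_right _),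
      hq.tsum_stepOp_pow hφ (pointFun_eq_zero j), tsum_mul_right, hq.hasSum_one.tsum_eq, one_mul]
    simp [pointFun]
  simp only [h3, tsum_zero] at h1
  simpa using h1.const_sub (q j)

lemma IsStationaryLaw.unique (ha : IsFiniteLaw a N) (hφ : IsBufferUpdate S φ)
    (hm : ∑ l ∈ Finset.range N, (l : ℝ) * a l < S) {q q' : ℕ → ℝ}
    (hq : IsStationaryLaw a N φ q) (hq' : IsStationaryLaw a N φ q') : q' = q :=
  funext fun j => tendsto_nhds_unique (hq'.tendsto ha hφ hm j) (hq.tendsto ha hφ hm j)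

/-- The mean content converges. -/
lemma exists_tendsto_mean (ha : IsFiniteLaw a N) (hφ : IsBufferUpdate S φ)
    (hm : ∑ l ∈ Finset.range N, (l : ℝ) * a l < S) :
    ∃ x, Tendsto (fun t => (stepOp a N φ ^ t) idFun 0) atTop (𝓝 x) := by
  obtain ⟨C, hC⟩ := exists_mean_bound ha hφ hm
  exact ⟨_, tendsto_atTop_ciSup (monotone_time_stepOp_pow ha hφ monotone_idFun)
    ⟨C, by rintro _ ⟨t, rfl⟩; exact hC t⟩⟩

/-- The correction is the unused playout capacity `S - i` when `i < S`; it is the origin of the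
weights `1 - i/S`. -/
lemma cast_max_sub (S i : ℕ) :
    ((max S i - S : ℕ) : ℝ) = i - S + ∑ k ∈ Finset.range S, ((S : ℝ) - k) * pointFun k i := by
  simp only [pointFun, mul_ite, mul_one, mul_zero, Finset.sum_ite_eq, Finset.mem_range]
  split_ifs with h
  · rw [max_eq_left h.le]; simp
  · rw [max_eq_right (not_lt.1 h), Nat.cast_sub (not_lt.1 h), add_zero]

/-- Mean number of packets left after the playout. -/
lemma stepOp_pow_max_sub (ha : IsFiniteLaw a N) (t : ℕ) :
    (stepOp a N φ ^ t) (fun i => ((max S i - S : ℕ) : ℝ)) 0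
      = (stepOp a N φ ^ t) idFun 0 - S
        + ∑ k ∈ Finset.range S, ((S : ℝ) - k) * (stepOp a N φ ^ t) (pointFun k) 0 := by
  have h : (fun i => ((max S i - S : ℕ) : ℝ))
      = idFun - (fun _ => (S : ℝ)) + ∑ k ∈ Finset.range S, ((S : ℝ) - k) • pointFun k := by
    ext i
    simp only [cast_max_sub, idFun, Pi.add_apply, Pi.sub_apply, Finset.sum_apply, Pi.smul_apply,
      smul_eq_mul]
  rw [h, map_add, map_sub, stepOp_pow_const ha, map_sum]
  simp

/-- In the stationary infinite buffer as many packets are played out as arrive. -/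
lemma stationary_throughput (ha : IsFiniteLaw a N)
    (hm : ∑ l ∈ Finset.range N, (l : ℝ) * a l < S) {q : ℕ → ℝ}
    (hq : IsStationaryLaw a N (queueUpdate S) q) :
    ∑ l ∈ Finset.range N, (l : ℝ) * a l = S - ∑ k ∈ Finset.range S, ((S : ℝ) - k) * q k := by
  have hφ := isBufferUpdate_queueUpdate S
  obtain ⟨x, hx⟩ := exists_tendsto_mean ha hφ hm
  have h1 := hx.comp (tendsto_add_atTop_nat 1)
  have h2 : stepOp a N (queueUpdate S) idFun = (fun i => ((max S i - S : ℕ) : ℝ))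
      + fun _ => ∑ l ∈ Finset.range N, (l : ℝ) * a l := by
    ext i
    simp only [stepOp_apply, idFun, queueUpdate, Nat.cast_add, mul_add, Finset.sum_add_distrib,
      ← Finset.sum_mul, ha.sum_one, one_mul, Pi.add_apply]
    simp only [mul_comm (a _)]
  have h3 : Tendsto (fun t => (stepOp a N (queueUpdate S) ^ (t + 1)) idFun 0) atTop
      (𝓝 (x - S + ∑ k ∈ Finset.range S, ((S : ℝ) - k) * q k
        + ∑ l ∈ Finset.range N, (l : ℝ) * a l)) := by
    simp only [stepOp_pow_succ', h2, map_add, stepOp_pow_const ha, Pi.add_apply,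
      stepOp_pow_max_sub ha]
    exact ((hx.sub_const _).add (tendsto_finsetSum _ fun k _ =>
      (hq.tendsto ha hφ hm k).const_mul _)).add_const _
  -- The limiting mean `x` is finite and cancels, leaving the balance of arrivals and departures.
  linarith [tendsto_nhds_unique h1 h3]

end Operator

/-! ### Transition matrices expressed by the operator -/

section Transition

variable {a : ℕ → ℝ} {N : ℕ}

lemma stepOp_queueUpdate_pointFun (ha : IsFiniteLaw a N) (S i j : ℕ) :
    stepOp a N (queueUpdate S) (pointFun j) i = queueTrans a S i j := by
  have key : ∀ w, ∑ l ∈ Finset.range N, a l * (if w + l = j then (1 : ℝ) else 0)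
      = if w ≤ j then a (j - w) else 0 := by
    intro w
    split_ifs with h
    · have : ∀ l, (w + l = j) ↔ l = j - w := fun l => by omega
      simp only [this, mul_ite, mul_one, mul_zero, Finset.sum_ite_eq', Finset.mem_range]
      split_ifs with h'
      · rfl
      · exact (ha.zero_of_le _ (not_lt.1 h')).symm
    · exact Finset.sum_eq_zero fun l _ => by rw [if_neg (by omega), mul_zero]
  refine (key (max S i - S)).trans ?_
  simp only [queueTrans]
  rcases le_total i S with h | h
  · simp [h]
  · rw [max_eq_right h]
    split_ifs <;> first | rfl | omega | (congr 1; omega)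

lemma stepOp_bufferUpdate_pointFun (ha : IsFiniteLaw a N) {B i j : ℕ} (S : ℕ) (hi : i ≤ B)
    (hj : j ≤ B) : stepOp a N (bufferUpdate B S) (pointFun j) i = bufferTrans a B S i j := by
  have hlt : ∀ k < B, stepOp a N (bufferUpdate B S) (pointFun k) i
      = stepOp a N (queueUpdate S) (pointFun k) i := fun k hk => by
    simp only [stepOp_apply]
    refine Finset.sum_congr rfl fun l _ => ?_
    rw [bufferUpdate_of_le S l hi]
    simp only [pointFun, queueUpdate]
    congr 2
    simp only [eq_iff_iff]; omega
  rcases hj.lt_or_eq with h | rfl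
  · rw [hlt j h, stepOp_queueUpdate_pointFun ha, bufferTrans, if_pos h]
  -- The full-buffer column is defined as a complement, so it suffices that each row of the operator
  -- has total mass one.
  · rw [bufferTrans, if_neg (lt_irrefl _), eq_sub_iff_add_eq]
    simp only [← stepOp_queueUpdate_pointFun ha]
    rw [← Finset.sum_congr rfl fun k hk => hlt k (Finset.mem_range.1 hk), add_comm,
      ← Finset.sum_range_succ]
    simp only [stepOp_apply]
    rw [Finset.sum_comm]
    rw [← ha.sum_one]
    refine Finset.sum_congr rfl fun l _ => ?_
    rw [← Finset.mul_sum, bufferUpdate_of_le S l hi]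
    simp [pointFun]

lemma stepOp_bufferUpdate_pointFun_of_lt {B i j : ℕ} (S : ℕ) (hi : i ≤ B) (hj : B < j) :
    stepOp a N (bufferUpdate B S) (pointFun j) i = 0 := by
  rw [stepOp_apply]
  refine Finset.sum_eq_zero fun l _ => ?_
  rw [bufferUpdate_of_le S l hi, pointFun, if_neg (by omega), mul_zero]

lemma isQueueStationary_iff (ha : IsFiniteLaw a N) (S : ℕ) (q : ℕ → ℝ) :
    IsQueueStationary a S q ↔ IsStationaryLaw a N (queueUpdate S) q := by
  constructor
  · rintro ⟨h1, h2, h3⟩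
    exact ⟨h1, h2, by simpa only [stepOp_queueUpdate_pointFun ha] using h3⟩
  · rintro ⟨h1, h2, h3⟩
    exact ⟨h1, h2, by simpa only [stepOp_queueUpdate_pointFun ha] using h3⟩

lemma isBufferStationary_iff (ha : IsFiniteLaw a N) (B S : ℕ) (q : ℕ → ℝ) :
    IsBufferStationary a B S q ↔
      IsStationaryLaw a N (bufferUpdate B S) q ∧ ∀ i, B < i → q i = 0 := by
  have hsum : ∀ f : ℕ → ℝ, (∀ i, B < i → f i = 0) →
      HasSum f (∑ i ∈ Finset.range (B + 1), f i) := fun f hf =>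
    hasSum_sum_of_ne_finset_zero fun i hi => hf i (by simpa using hi)
  have hbal : ∀ j ≤ B, ∑ i ∈ Finset.range (B + 1), q i * bufferTrans a B S i j
      = ∑ i ∈ Finset.range (B + 1), q i * stepOp a N (bufferUpdate B S) (pointFun j) i :=
    fun j hj => Finset.sum_congr rfl fun i hi => by
      rw [stepOp_bufferUpdate_pointFun ha S (by simpa [Nat.lt_succ_iff] using hi) hj]
  constructor
  · rintro ⟨h1, h2, h3, h4⟩
    refine ⟨⟨h1, h3 ▸ hsum q h2, fun j => ?_⟩, h2⟩
    have hs := hsum (fun i => q i * stepOp a N (bufferUpdate B S) (pointFun j) i)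
      fun i hi => by rw [h2 i hi, zero_mul]
    rcases le_or_gt j B with hj | hj
    · rwa [← hbal j hj, h4 j hj] at hs
    · rw [h2 j hj]
      rwa [Finset.sum_eq_zero fun i hi => ?_] at hs
      rw [stepOp_bufferUpdate_pointFun_of_lt S (by simpa [Nat.lt_succ_iff] using hi) hj, mul_zero]
  · rintro ⟨⟨h1, h2, h3⟩, h4⟩
    refine ⟨h1, h4, (hsum q h4).unique h2, fun j hj => ?_⟩
    rw [hbal j hj]
    exact (hsum _ fun i hi => by rw [h4 i hi, zero_mul]).unique (h3 j)

lemma pmfMean_eq_sum (ha : IsFiniteLaw a N) :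
    pmfMean a = ∑ l ∈ Finset.range N, (l : ℝ) * a l :=
  tsum_eq_sum fun l hl => by rw [ha.zero_of_le l (by simpa using hl), mul_zero]

lemma exists_unique_isQueueStationary {S : ℕ} (ha : IsFiniteLaw a N) (hm : pmfMean a < S) :
    ∃ q, IsQueueStationary a S q ∧ ∀ q', IsQueueStationary a S q' → q' = q := by
  rw [pmfMean_eq_sum ha] at hm
  have hφ := isBufferUpdate_queueUpdate S
  obtain ⟨q, hq, -⟩ := exists_stationary_limit ha hφ hm
  simp only [isQueueStationary_iff ha]
  exact ⟨q, hq, fun q' hq' => hq.unique ha hφ hm hq'⟩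

lemma exists_unique_isBufferStationary {S : ℕ} (ha : IsFiniteLaw a N) (B : ℕ)
    (hm : pmfMean a < S) :
    ∃ q, IsBufferStationary a B S q ∧ ∀ q', IsBufferStationary a B S q' → q' = q := by
  rw [pmfMean_eq_sum ha] at hm
  have hφ := isBufferUpdate_bufferUpdate B S
  obtain ⟨q, hq, hlim⟩ := exists_stationary_limit ha hφ hm
  simp only [isBufferStationary_iff ha]
  refine ⟨q, ⟨hq, fun j hj => ?_⟩, fun q' hq' => hq.unique ha hφ hm hq'.1⟩
  -- Started empty, the chain never exceeds `B`, so its limit law has no mass there.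
  refine tendsto_nhds_unique (hlim j) (tendsto_const_nhds.congr fun t => Eq.symm ?_)
  have key : ∀ t i, i ≤ B → (stepOp a N (bufferUpdate B S) ^ t) (pointFun j) i = 0 := by
    intro t
    induction t with
    | zero => intro i hi; simp only [pow_zero, Module.End.one_apply, pointFun]; rw [if_neg (by omega)]
    | succ t ih =>
      intro i hi
      rw [stepOp_pow_succ, stepOp_apply]
      refine Finset.sum_eq_zero fun l _ => ?_
      rw [ih _ (by rw [bufferUpdate_of_le S l hi]; exact min_le_left _ _), mul_zero]
  exact key t 0 (Nat.zero_le _)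

end Transition

/-! ### From content processes to outage and drop rate -/

section Contents

/-- Content process with update `φ` and arrivals `A`, started from the empty buffer. -/
def contents {Ω : Type*} (φ : ℕ → ℕ → ℕ) (A : ℕ → Ω → ℕ) : ℕ → Ω → ℕ
  | 0, _ => 0
  | t + 1, ω => φ (contents φ A t ω) (A t ω)

lemma queue_eq_contents {Ω : Type*} (S : ℕ) (A : ℕ → Ω → ℕ) :
    queue S A = contents (queueUpdate S) A := by
  ext t ω
  induction t with
  | zero => rfl
  | succ t ih => simp only [queue, contents, ih, queueUpdate]

lemma bufferQueue_le {Ω : Type*} (B S : ℕ) (A : ℕ → Ω → ℕ) (t : ℕ) (ω : Ω) :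
    bufferQueue B S A t ω ≤ B := by
  cases t with
  | zero => exact Nat.zero_le _
  | succ t => exact min_le_left _ _

lemma bufferQueue_eq_contents {Ω : Type*} (B S : ℕ) (A : ℕ → Ω → ℕ) :
    bufferQueue B S A = contents (bufferUpdate B S) A := by
  ext t ω
  induction t with
  | zero => rfl
  | succ t ih =>
    simp only [contents]
    rw [← ih, bufferUpdate_of_le S _ (bufferQueue_le B S A t ω)]
    rfl

lemma contents_congr {Ω Ω' : Type*} (φ : ℕ → ℕ → ℕ) {A : ℕ → Ω → ℕ} {A' : ℕ → Ω' → ℕ} {ω : Ω}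
    {ω' : Ω'} {t : ℕ} (h : ∀ s < t, A s ω = A' s ω') : contents φ A t ω = contents φ A' t ω' := by
  induction t with
  | zero => rfl
  | succ t ih =>
    simp only [contents]
    rw [ih fun s hs => h s (by omega), h t (by omega)]

lemma contents_lt {Ω : Type*} {S N : ℕ} {φ : ℕ → ℕ → ℕ} (hφ : IsBufferUpdate S φ)
    {A : ℕ → Ω → ℕ} (hN : ∀ t ω, A t ω < N) (t : ℕ) (ω : Ω) : contents φ A t ω < t * N + 1 := by
  induction t with
  | zero => simp [contents]
  | succ t ih =>
    simp only [contents]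
    have h1 := hφ.upper (contents φ A t ω) (A t ω)
    have h2 := hN t ω
    rw [add_mul]
    omega

variable {Ω : Type*} [MeasurableSpace Ω] {μ : Measure Ω}

lemma measurable_contents (φ : ℕ → ℕ → ℕ) {A : ℕ → Ω → ℕ} (hA : ∀ t, Measurable (A t)) (t : ℕ) :
    Measurable (contents φ A t) := by
  induction t with
  | zero => exact measurable_const
  | succ t ih =>
    exact (Measurable.of_discrete (f := Function.uncurry φ)).comp (ih.prodMk (hA t))

/-- The content at time `t` is a function of the arrivals strictly before `t`. -/
lemma indepFun_contents (φ : ℕ → ℕ → ℕ) {A : ℕ → Ω → ℕ} (hA : ∀ t, Measurable (A t))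
    (hi : iIndepFun A μ) (t : ℕ) : IndepFun (contents φ A t) (A t) μ := by
  have h := (hi.indepFun_finset (Finset.range t) {t} (by simp) hA).comp
    (φ := fun v : Finset.range t → ℕ => contents φ
      (fun s (_ : Unit) => if hs : s ∈ Finset.range t then v ⟨s, hs⟩ else 0) t ())
    (ψ := fun v : ({t} : Finset ℕ) → ℕ => v ⟨t, by simp⟩) .of_discrete .of_discrete
  have h1 : contents φ A t = (fun v : Finset.range t → ℕ => contents φ
      (fun s (_ : Unit) => if hs : s ∈ Finset.range t then v ⟨s, hs⟩ else 0) t ()) ∘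
      fun ω (i : Finset.range t) => A i ω := by
    ext ω
    exact contents_congr φ fun s hs => by simp [hs]
  rw [h1]
  exact h

lemma integral_pointFun {X : Ω → ℕ} (hX : Measurable X) (j : ℕ) :
    ∫ ω, pointFun j (X ω) ∂μ = μ.real {ω | X ω = j} := by
  have h : (fun ω => pointFun j (X ω)) = {ω | X ω = j}.indicator fun _ => (1 : ℝ) := by
    ext ω; simp [pointFun, Set.indicator]
  have hm : MeasurableSet {ω | X ω = j} := hX (measurableSet_singleton j)
  rw [h, integral_indicator_const _ hm, smul_eq_mul, mul_one]

variable [IsProbabilityMeasure μ]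

lemma integrable_comp_of_lt {X : Ω → ℕ} (hX : Measurable X) {N : ℕ} (hN : ∀ ω, X ω < N)
    (f : ℕ → ℝ) : Integrable (fun ω => f (X ω)) μ := by
  refine Integrable.of_bound (Measurable.of_discrete.comp hX).aestronglyMeasurable
    (∑ l ∈ Finset.range N, |f l|) (.of_forall fun ω => ?_)
  rw [Real.norm_eq_abs]
  exact Finset.single_le_sum (f := fun l => |f l|) (fun l _ => abs_nonneg _)
    (Finset.mem_range.2 (hN ω))

lemma integral_comp_of_lt {X : Ω → ℕ} (hX : Measurable X) {N : ℕ} (hN : ∀ ω, X ω < N)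
    (f : ℕ → ℝ) :
    ∫ ω, f (X ω) ∂μ = ∑ l ∈ Finset.range N, μ.real {ω | X ω = l} * f l := by
  have h : ∀ ω, f (X ω) = ∑ l ∈ Finset.range N, {ω | X ω = l}.indicator (fun _ => f l) ω := by
    intro ω
    rw [Finset.sum_eq_single_of_mem _ (Finset.mem_range.2 (hN ω))]
    · simp
    · intro l _ hl
      exact Set.indicator_of_notMem (fun h' => hl (Eq.symm h')) _
  have hm : ∀ l, MeasurableSet {ω | X ω = l} := fun l => hX (measurableSet_singleton l)
  simp only [h]
  rw [integral_finsetSum _ fun l _ => (integrable_const _).indicator (hm l)]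
  exact Finset.sum_congr rfl fun l _ => by rw [integral_indicator_const _ (hm l), smul_eq_mul]

/-- The law of the content is given by the powers of the transition operator. -/
lemma integral_contents {a : ℕ → ℝ} {N S : ℕ} {φ : ℕ → ℕ → ℕ} (hφ : IsBufferUpdate S φ)
    {A : ℕ → Ω → ℕ} (hA : ∀ t, Measurable (A t)) (hi : iIndepFun A μ) (hN : ∀ t ω, A t ω < N)
    (hlaw : ∀ t l, μ.real {ω | A t ω = l} = a l) (t : ℕ) (f : ℕ → ℝ) :
    ∫ ω, f (contents φ A t ω) ∂μ = (stepOp a N φ ^ t) f 0 := by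
  induction t generalizing f with
  | zero => simp [contents]
  | succ t ih =>
    have hX := measurable_contents φ hA t
    -- Splitting by the value of the last arrival lets independence factor each term; the induction
    -- hypothesis is then applied to `stepOp a N φ f`.
    have h1 : ∀ ω, f (contents φ A (t + 1) ω)
        = ∑ l ∈ Finset.range N, pointFun l (A t ω) * f (φ (contents φ A t ω) l) := fun ω => by
      rw [Finset.sum_eq_single_of_mem _ (Finset.mem_range.2 (hN t ω))]
      · simp [pointFun, contents]
      · intro l _ hl
        rw [pointFun, if_neg hl.symm, zero_mul]
    have hind : ∀ l, IndepFun (fun ω => pointFun l (A t ω))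
        (fun ω => f (φ (contents φ A t ω) l)) μ := fun l =>
      (indepFun_contents φ hA hi t).symm.comp (φ := pointFun l) (ψ := fun i => f (φ i l))
        .of_discrete .of_discrete
    have hint1 := fun l => integrable_comp_of_lt (μ := μ) (hA t) (hN t) (pointFun l)
    have hint2 := fun l => integrable_comp_of_lt (μ := μ) hX (contents_lt hφ hN t)
      fun i => f (φ i l)
    have hint3 : ∀ l, Integrable (fun ω => pointFun l (A t ω) * f (φ (contents φ A t ω) l)) μ :=
      fun l => (hind l).integrable_mul (hint1 l) (hint2 l)
    simp only [h1]
    rw [integral_finsetSum _ fun l _ => hint3 l,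
      stepOp_pow_succ', ← ih]
    simp only [stepOp_apply]
    rw [integral_finsetSum _ fun l _ => (hint2 l).const_mul _]
    refine Finset.sum_congr rfl fun l _ => ?_
    rw [(hind l).integral_fun_mul_eq_mul_integral (hint1 l).aestronglyMeasurable
      (hint2 l).aestronglyMeasurable, integral_pointFun (hA t), hlaw, integral_const_mul]

lemma measureReal_lt_eq_sum {X : Ω → ℕ} (hX : Measurable X) (S : ℕ) :
    μ.real {ω | X ω < S} = ∑ i ∈ Finset.range S, μ.real {ω | X ω = i} := by
  have h : {ω | X ω < S} = ⋃ i ∈ Finset.range S, {ω | X ω = i} := by ext ω; simp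
  rw [h, measureReal_biUnion_finset]
  · intro i _ j _ hij
    exact Set.disjoint_left.2 fun ω h1 h2 => hij (Eq.trans (Eq.symm h1) h2)
  · exact fun i _ => hX (measurableSet_singleton i)

lemma isFiniteLaw_of_law {a : ℕ → ℝ} {N : ℕ} {X : Ω → ℕ} (hX : Measurable X)
    (hN : ∀ ω, X ω < N) (hlaw : ∀ l, μ.real {ω | X ω = l} = a l) : IsFiniteLaw a N where
  nonneg l := hlaw l ▸ measureReal_nonneg
  zero_of_le l hl := by
    have : {ω | X ω = l} = ∅ := by
      ext ω; simpa using fun h => absurd (hN ω) (by omega)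
    rw [← hlaw, this, measureReal_empty]
  sum_one := by
    have h := integral_comp_of_lt (μ := μ) hX hN fun _ => 1
    simpa [hlaw] using h.symm

lemma integral_cast_eq_mean {a : ℕ → ℝ} {N : ℕ} {X : Ω → ℕ} (hX : Measurable X)
    (hN : ∀ ω, X ω < N) (hlaw : ∀ l, μ.real {ω | X ω = l} = a l) :
    ∫ ω, (X ω : ℝ) ∂μ = ∑ l ∈ Finset.range N, (l : ℝ) * a l := by
  rw [integral_comp_of_lt hX hN fun l => (l : ℝ)]
  exact Finset.sum_congr rfl fun l _ => by rw [hlaw, mul_comm]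

/-- Long-run behaviour of a user whose arrivals are i.i.d. with law `a`. -/
structure HasLongRun (μ : Measure Ω) (B S : ℕ) (A : ℕ → Ω → ℕ) (qB q : ℕ → ℝ) : Prop where
  buffer : ∀ i, Tendsto (fun t => μ.real {ω | bufferQueue B S A t ω = i}) atTop (𝓝 (qB i))
  queue : ∀ i, Tendsto (fun t => μ.real {ω | queue S A t ω = i}) atTop (𝓝 (q i))
  outage : HasOutage μ B S A (∑ i ∈ Finset.range S, qB i)
  dropRate : HasDropRate μ B S A (dropFormula S qB q)

/-- Playout balance: `1 - ∑_{i<S} (1 - i/S) q_i = E[A] / S`. -/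
lemma one_sub_sum_eq {a : ℕ → ℝ} {N S : ℕ} (ha : IsFiniteLaw a N) (hS : 0 < S)
    (hm : pmfMean a < S) {q : ℕ → ℝ} (hq : IsQueueStationary a S q) :
    1 - ∑ i ∈ Finset.range S, (1 - (i : ℝ) / S) * q i = pmfMean a / S := by
  have hS' : (S : ℝ) ≠ 0 := by positivity
  rw [pmfMean_eq_sum ha] at hm ⊢
  rw [stationary_throughput ha hm ((isQueueStationary_iff ha S q).1 hq), sub_div, div_self hS',
    Finset.sum_div]
  congr 1
  exact Finset.sum_congr rfl fun i _ => by field_simp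

lemma hasLongRun {a : ℕ → ℝ} {N B S : ℕ} (hS : 0 < S) (hmean0 : 0 < pmfMean a)
    (hmean : pmfMean a < S) {A : ℕ → Ω → ℕ} (hA : ∀ t, Measurable (A t)) (hi : iIndepFun A μ)
    (hN : ∀ t ω, A t ω < N) (hlaw : ∀ t l, μ.real {ω | A t ω = l} = a l) {qB q : ℕ → ℝ}
    (hqB : IsBufferStationary a B S qB) (hq : IsQueueStationary a S q) :
    HasLongRun μ B S A qB q := by
  have ha : IsFiniteLaw a N := isFiniteLaw_of_law (hA 0) (hN 0) (hlaw 0)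
  have hden := one_sub_sum_eq ha hS hmean hq
  have hEA := fun t => integral_cast_eq_mean (hA t) (hN t) (hlaw t)
  have hpm := pmfMean_eq_sum ha
  have hm := hpm ▸ hmean
  have hφB := isBufferUpdate_bufferUpdate B S
  have hφ := isBufferUpdate_queueUpdate S
  have hmQB : ∀ t, Measurable (bufferQueue B S A t) :=
    bufferQueue_eq_contents B S A ▸ measurable_contents _ hA
  have hbuf : ∀ t f, ∫ ω, f (bufferQueue B S A t ω) ∂μ
      = (stepOp a N (bufferUpdate B S) ^ t) f 0 := by
    rw [bufferQueue_eq_contents]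
    exact integral_contents hφB hA hi hN hlaw
  have hbuffer : ∀ i, Tendsto (fun t => μ.real {ω | bufferQueue B S A t ω = i}) atTop
      (𝓝 (qB i)) := fun i => by
    simp only [← integral_pointFun (hmQB _), hbuf]
    exact ((isBufferStationary_iff ha B S qB).1 hqB).1.tendsto ha hφB hm i
  refine ⟨hbuffer, fun i => ?_, ?_, ?_⟩
  · simp only [queue_eq_contents, ← integral_pointFun (measurable_contents _ hA _),
      integral_contents hφ hA hi hN hlaw]
    exact ((isQueueStationary_iff ha S q).1 hq).tendsto ha hφ hm i
  · simp only [HasOutage, measureReal_lt_eq_sum (hmQB _)]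
    exact tendsto_finsetSum _ fun i _ => hbuffer i
  · obtain ⟨x, hx⟩ := exists_tendsto_mean ha hφB hm
    -- Conservation: lost packets are those left after playout plus arrivals minus the next content.
    have hlost : ∀ t, ∫ ω, (lostPackets B S A t ω : ℝ) ∂μ
        = pmfMean a - S + ∑ k ∈ Finset.range S, ((S : ℝ) - k) * μ.real {ω | bufferQueue B S A t ω = k}
          + ((stepOp a N (bufferUpdate B S) ^ t) idFun 0
            - (stepOp a N (bufferUpdate B S) ^ (t + 1)) idFun 0) := fun t => by
      have h1 : ∀ ω, (lostPackets B S A t ω : ℝ)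
          = ((max S (bufferQueue B S A t ω) - S : ℕ) : ℝ) + A t ω
            - idFun (bufferQueue B S A (t + 1) ω) := fun ω => by
        rw [idFun, eq_sub_iff_add_eq]
        norm_cast
        simp only [lostPackets, bufferQueue]
        omega
      have hlt : ∀ t ω, bufferQueue B S A t ω < B + 1 := fun t ω =>
        Nat.lt_succ_of_le (bufferQueue_le B S A t ω)
      have hi1 := integrable_comp_of_lt (μ := μ) (hmQB t) (hlt t)
        fun i => ((max S i - S : ℕ) : ℝ)
      have hi2 := integrable_comp_of_lt (μ := μ) (hA t) (hN t) fun i => (i : ℝ)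
      have hi3 := integrable_comp_of_lt (μ := μ) (hmQB (t + 1)) (hlt (t + 1)) idFun
      have hi12 : Integrable (fun ω => ((max S (bufferQueue B S A t ω) - S : ℕ) : ℝ)
          + (A t ω : ℝ)) μ := hi1.add hi2
      simp only [h1]
      rw [integral_sub hi12 hi3, integral_add hi1 hi2, hEA, ← hpm, hbuf,
        hbuf t fun i => ((max S i - S : ℕ) : ℝ), stepOp_pow_max_sub ha]
      simp only [← hbuf, integral_pointFun (hmQB _)]
      ring
    have hlim : Tendsto (fun t => ∫ ω, (lostPackets B S A t ω : ℝ) ∂μ) atTop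
        (𝓝 (pmfMean a - S + ∑ k ∈ Finset.range S, ((S : ℝ) - k) * qB k)) := by
      simp only [hlost]
      have h2 := hx.sub (hx.comp (tendsto_add_atTop_nat 1))
      rw [sub_self] at h2
      simpa using (tendsto_const_nhds.add
        (tendsto_finsetSum _ fun k _ => (hbuffer k).const_mul ((S : ℝ) - k))).add h2
    have hval : dropFormula S qB q
        = (pmfMean a - S + ∑ k ∈ Finset.range S, ((S : ℝ) - k) * qB k) / pmfMean a := by
      have hS' : (S : ℝ) ≠ 0 := by positivity
      have h3 : ∑ i ∈ Finset.range S, (1 - (i : ℝ) / S) * qB i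
          = (∑ k ∈ Finset.range S, ((S : ℝ) - k) * qB k) / S := by
        rw [Finset.sum_div]
        exact Finset.sum_congr rfl fun i _ => by field_simp
      have h4 : ∑ i ∈ Finset.range S, (1 - (i : ℝ) / S) * q i = 1 - pmfMean a / S := by
        linarith
      rw [dropFormula, hden]
      simp only [mul_sub, Finset.sum_sub_distrib]
      rw [h3, h4]
      field_simp
      ring
    rw [HasDropRate, hval]
    simp only [hEA, ← hpm, Finset.sum_const, Finset.card_range, nsmul_eq_mul]
    -- The expected arrivals total `T * E[A]`, so the ratio is a Cesàro mean divided by `E[A]`.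
    refine (hlim.cesaro.div_const (pmfMean a)).congr fun T => ?_
    rw [← div_div, inv_mul_eq_div]

end Contents

/-! ### Rate cancellation and bounded arrivals -/

section Rates

variable {Ω : Type*} {n m : ℕ} {r : Fin m → ℝ} {R : Fin n → ℕ → Ω → ℝ}

lemma dataRate_frameRatio {K : ℕ} (hR : ∀ i t ω, 0 < R i t ω) (i : Fin n) (t : ℕ) (ω : Ω) :
    dataRate K (frameRatio R) R i t ω = commonRate K R t ω := by
  have := (hR i t ω).ne'
  simp only [dataRate, frameRatio, commonRate]
  field_simp

lemma exists_userArrivals_lt {K : ℕ} {Δ σ : ℝ} (hr0 : ∀ k, 0 < r k)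
    (hRval : ∀ i t ω, R i t ω ∈ Set.range r) :
    ∃ N, ∀ (u : Fin n) (t : ℕ) (ω : Ω), userArrivals K Δ σ R u t ω < N := by
  -- Summing over the finitely many rate vectors is a cheap substitute for a maximum.
  refine ⟨(∑ k : Fin n → Fin m, ⌊(K / ∑ j, 1 / r (k j)) * Δ / σ⌋₊) + 1, fun u t ω => ?_⟩
  have hR : ∀ i t ω, 0 < R i t ω := fun i t ω => by
    obtain ⟨k, hk⟩ := hRval i t ω; exact hk ▸ hr0 k
  choose k hk using fun j => hRval j t ω
  simp only [userArrivals, arrivals, dataRate_frameRatio hR, commonRate, ← hk]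
  exact Nat.lt_succ_of_le (Finset.single_le_sum
    (f := fun k : Fin n → Fin m => ⌊(K / ∑ j, 1 / r (k j)) * Δ / σ⌋₊)
    (fun _ _ => Nat.zero_le _) (Finset.mem_univ k))

end Rates

/-! ### Independence across frames and one-frame laws -/

section Laws

variable {Ω : Type*} [MeasurableSpace Ω] {μ : Measure Ω}

/-- The rows of an independent array are independent. -/
lemma iIndepFun_rows {ι κ E : Type*} [MeasurableSpace E] [IsProbabilityMeasure μ]
    {X : ι → κ → Ω → E} (hX : ∀ i j, Measurable (X i j))
    (h : iIndepFun (fun p : (_ : ι) × κ => X p.1 p.2) μ) :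
    iIndepFun (fun i ω j => X i j ω) μ := by
  have hP : ∀ i j, IsProbabilityMeasure (μ.map (X i j)) :=
    fun i j => Measure.isProbabilityMeasure_map (hX i j).aemeasurable
  have hrow : ∀ i, μ.map (fun ω j => X i j ω) = Measure.infinitePi fun j => μ.map (X i j) :=
    fun i => (h.precomp (g := fun j : κ => (⟨i, j⟩ : (_ : ι) × κ))
      (fun _ _ h => by simpa using h)).map_fun_eq_infinitePi_map (hX i)
  rw [iIndepFun_iff_map_fun_eq_infinitePi_map fun i => measurable_pi_iff.2 (hX i)]
  simp only [hrow]
  -- Currying carries the product law of the whole array to the product of the row laws.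
  rw [← Measure.infinitePi_map_piCurry (X := fun _ _ => E) (fun i j => μ.map (X i j)),
    ← h.map_fun_eq_infinitePi_map (X := fun p : (_ : ι) × κ => X p.1 p.2) (fun p => hX p.1 p.2),
    Measure.map_map (f := fun ω (p : (_ : ι) × κ) => X p.1 p.2 ω) (MeasurableEquiv.measurable _)
      (measurable_pi_iff.2 fun p => hX p.1 p.2)]
  rfl

variable {n m : ℕ} {r : Fin m → ℝ} {p : Fin n → Fin m → ℝ} {R : Fin n → ℕ → Ω → ℝ}

lemma measureReal_rates_eq (hRp : ∀ i t k, μ.real {ω | R i t ω = r k} = p i k)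
    (hRindep : iIndepFun (fun x : Fin n × ℕ => R x.1 x.2) μ) (t : ℕ) (k : Fin n → Fin m) :
    μ.real {ω | ∀ j, R j t ω = r (k j)} = ∏ j, p j (k j) := by
  have h := (hRindep.precomp (g := fun j : Fin n => (j, t))
    fun _ _ h => (Prod.mk.inj h).1).measure_inter_preimage_eq_mul Finset.univ
    (sets := fun j => {r (k j)}) fun j _ => measurableSet_singleton _
  have hs : {ω | ∀ j, R j t ω = r (k j)}
      = ⋂ j ∈ (Finset.univ : Finset (Fin n)), (R j t) ⁻¹' {r (k j)} := by ext ω; simp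
  rw [hs, Measure.real]
  refine (congrArg ENNReal.toReal h).trans ?_
  rw [ENNReal.toReal_prod]
  exact Finset.prod_congr rfl fun j _ => hRp j t (k j)

/-- The probability of an event which depends on the rates in one frame. -/
lemma measureReal_rate_event [IsProbabilityMeasure μ] (hr : StrictMono r)
    (hRmeas : ∀ i t, Measurable (R i t)) (hRval : ∀ i t ω, R i t ω ∈ Set.range r)
    (hRp : ∀ i t k, μ.real {ω | R i t ω = r k} = p i k)
    (hRindep : iIndepFun (fun x : Fin n × ℕ => R x.1 x.2) μ) (t : ℕ)
    (P : (Fin n → ℝ) → Prop) [DecidablePred P] :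
    μ.real {ω | P fun j => R j t ω}
      = ∑ k : Fin n → Fin m, (∏ j, p j (k j)) * (if P fun j => r (k j) then 1 else 0) := by
  have hs : {ω | P fun j => R j t ω} = ⋃ k ∈ Finset.univ.filter fun k : Fin n → Fin m =>
      P fun j => r (k j), {ω | ∀ j, R j t ω = r (k j)} := by
    ext ω
    simp only [Set.mem_ofPred_eq, Finset.mem_filter, Finset.mem_univ, true_and, Set.mem_iUnion,
      exists_prop]
    constructor
    · intro h
      choose k hk using fun j => hRval j t ω
      exact ⟨k, by simpa only [hk] using h, fun j => (hk j).symm⟩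
    · rintro ⟨k, hP, hk⟩
      simpa only [hk] using hP
  rw [hs, measureReal_biUnion_finset]
  · simp only [measureReal_rates_eq hRp hRindep, Finset.sum_filter, mul_ite, mul_one, mul_zero]
  · intro k _ k' _ hkk'
    refine Set.disjoint_left.2 fun ω h1 h2 => hkk' (funext fun j => hr.injective ?_)
    exact (h1 j).symm.trans (h2 j)
  · intro k _
    have : {ω | ∀ j, R j t ω = r (k j)} = ⋂ j, {ω | R j t ω = r (k j)} := by ext; simp
    rw [this]
    exact MeasurableSet.iInter fun j => hRmeas j t (measurableSet_singleton _)

lemma sum_inv_pos (hn : 0 < n) {v : Fin n → ℝ} (hv : ∀ j, 0 < v j) : 0 < ∑ j, 1 / v j :=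
  Finset.sum_pos (fun j _ => one_div_pos.2 (hv j)) ⟨⟨0, hn⟩, Finset.mem_univ _⟩

lemma div_eq_iff_div_sub_eq_zero {c s x : ℝ} (hs : 0 < s) (hx : 0 < x) :
    c / s = x ↔ c / x - s = 0 := by
  rw [sub_eq_zero, div_eq_iff hs.ne', div_eq_iff hx.ne', mul_comm]

lemma mul_div_eq_iff {c s Δ σ x : ℝ} (hs : 0 < s) (hσ : 0 < σ) (hx : 0 < x) :
    c / s * Δ / σ = x ↔ c * Δ / (σ * x) - s = 0 := by
  rw [sub_eq_zero, div_eq_iff hσ.ne', div_mul_eq_mul_div, div_eq_iff hs.ne',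
    div_eq_iff (by positivity)]
  constructor <;> intro h <;> linarith

lemma ratePMF_eq_exactArrivalPMF {K : ℕ} {Δ σ : ℝ} (i : ℕ) :
    ratePMF K r p (σ / Δ * i) = exactArrivalPMF K Δ σ r p i := by
  have h : (K : ℝ) / (σ / Δ * i) = K * Δ / (σ * i) := by
    rw [div_mul_eq_mul_div, div_div_eq_mul_div]
  simp only [ratePMF, exactArrivalPMF, h]

/-- Rate vectors of probability zero contribute nothing to either sum; on the others the floor acts
on a positive integer. -/
lemma arrivalPMF_of_integral {K : ℕ} {Δ σ : ℝ} (hn : 0 < n) (hK : 0 < K) (hΔ : 0 < Δ) (hσ : 0 < σ)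
    (hr0 : ∀ k, 0 < r k)
    (h : ∀ k : Fin n → Fin m, (∏ j, p j (k j)) ≠ 0 →
      ∃ N : ℕ, (K / ∑ j, 1 / r (k j)) * Δ / σ = N) :
    arrivalPMF K Δ σ r p 0 = 0 ∧
      ∀ i : ℕ, 0 < i → arrivalPMF K Δ σ r p i = exactArrivalPMF K Δ σ r p i := by
  have hs := fun k : Fin n → Fin m => sum_inv_pos hn fun j => hr0 (k j)
  have hK' : (0 : ℝ) < K := by exact_mod_cast hK
  constructor
  · refine Finset.sum_eq_zero fun k _ => ?_
    by_cases hp : ∏ j, p j (k j) = 0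
    · rw [hp, zero_mul]
    · obtain ⟨N, hN⟩ := h k hp
      have hpos : (0 : ℝ) < N := by rw [← hN]; have := hs k; positivity
      rw [hN, Nat.floor_natCast, if_neg (by exact_mod_cast hpos.ne'), mul_zero]
  · intro i hi
    refine Finset.sum_congr rfl fun k _ => ?_
    by_cases hp : ∏ j, p j (k j) = 0
    · rw [hp, zero_mul, zero_mul]
    · obtain ⟨N, hN⟩ := h k hp
      congr 1
      refine if_congr ?_ rfl rfl
      rw [← mul_div_eq_iff (hs k) hσ (by exact_mod_cast hi), hN, Nat.floor_natCast, Nat.cast_inj]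

lemma iIndepFun_userArrivals [IsProbabilityMeasure μ] {K : ℕ} {Δ σ : ℝ}
    (hR : ∀ i t ω, 0 < R i t ω) (hRmeas : ∀ i t, Measurable (R i t))
    (hRindep : iIndepFun (fun x : Fin n × ℕ => R x.1 x.2) μ) (u : Fin n) :
    (∀ t, Measurable (userArrivals K Δ σ R u t)) ∧ iIndepFun (userArrivals K Δ σ R u) μ := by
  have hrow := iIndepFun_rows (X := fun t i => R i t) (fun t i => hRmeas i t)
    (hRindep.precomp (g := fun x : (_ : ℕ) × Fin n => (x.2, x.1)) fun x y h => by
      obtain ⟨h1, h2⟩ := Prod.mk.inj h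
      cases x; cases y; simp_all)
  have hG : Measurable fun v : Fin n → ℝ => ⌊(K / ∑ j, 1 / v j) * Δ / σ⌋₊ :=
    Nat.measurable_floor.comp (by fun_prop)
  have heq : userArrivals K Δ σ R u
      = fun t => (fun v : Fin n → ℝ => ⌊(K / ∑ j, 1 / v j) * Δ / σ⌋₊) ∘ fun ω j => R j t ω := by
    ext t ω
    simp only [userArrivals, arrivals, dataRate_frameRatio hR, commonRate, Function.comp]
  rw [heq]
  exact ⟨fun t => hG.comp (measurable_pi_iff.2 fun j => hRmeas j t), hrow.comp _ fun _ => hG⟩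

end Laws

/-- The rates given by the stationary formulas have a greatest element, which is the greatest
achievable rate. -/
lemma exists_isGreatest_rates {Ω : Type*} [MeasurableSpace Ω] {μ : Measure Ω} {a : ℕ → ℝ} {B : ℕ}
    {Δ σ ε δ₀ : ℝ} (hΔ : 0 < Δ) (hσ : 0 < σ) {ι : Type*} [Nonempty ι] {A : ι → ℕ → Ω → ℕ}
    (hlong : ∀ S : ℕ, 0 < S → S < B → pmfMean a < S →
      ∃ qB q : ℕ → ℝ, (IsBufferStationary a B S qB ∧ ∀ q', IsBufferStationary a B S q' → q' = qB) ∧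
        (IsQueueStationary a S q ∧ ∀ q', IsQueueStationary a S q' → q' = q) ∧
        ∀ u, HasOutage μ B S (A u) (∑ i ∈ Finset.range S, qB i) ∧
          HasDropRate μ B S (A u) (dropFormula S qB q))
    (hne : (formulaRates a B Δ σ ε δ₀).Nonempty) :
    ∃ U, IsGreatest (formulaRates a B Δ σ ε δ₀) U ∧
      (∀ u, IsGreatest (achievableRates μ B Δ σ ε δ₀ (A u)) U) ∧
      IsGreatest {v | ∀ u, v ∈ achievableRates μ B Δ σ ε δ₀ (A u)} U := by
  have hfin : (formulaRates a B Δ σ ε δ₀).Finite := by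
    refine (Set.finite_lt_nat B).image (fun S : ℕ => S * σ / Δ) |>.subset ?_
    rintro _ ⟨S, -, hSB, -, rfl, -⟩
    exact ⟨S, hSB, rfl⟩
  obtain ⟨U, hU, hmax⟩ := Set.exists_max_image _ id hfin hne
  have hach : ∀ u, U ∈ achievableRates μ B Δ σ ε δ₀ (A u) := fun u => by
    obtain ⟨S, hS, hSB, hm, rfl, qB', q', hqB', hq', he, hd⟩ := hU
    obtain ⟨qB, q, ⟨-, huB⟩, ⟨-, hu⟩, hlim⟩ := hlong S hS hSB hm
    rw [huB qB' hqB'] at he hd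
    rw [hu q' hq'] at hd
    exact ⟨S, hS, hSB, rfl, ⟨_, (hlim u).1, he⟩, _, (hlim u).2, hd⟩
  have hub : ∀ u, ∀ v ∈ achievableRates μ B Δ σ ε δ₀ (A u), v ≤ U := by
    rintro u _ ⟨S, hS, hSB, rfl, ⟨e, he, he'⟩, d, hd, hd'⟩
    rcases lt_or_ge (pmfMean a) S with hm | hm
    · obtain ⟨qB, q, ⟨hqB, -⟩, ⟨hq, -⟩, hlim⟩ := hlong S hS hSB hm
      rw [tendsto_nhds_unique he (hlim u).1] at he'
      rw [tendsto_nhds_unique hd (hlim u).2] at hd'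
      exact hmax _ ⟨S, hS, hSB, hm, rfl, qB, q, hqB, hq, he', hd'⟩
    -- Here `S ≤ E[A] < S₀`, so no formula for the long run at `S` is needed.
    · obtain ⟨S₀, -, -, hm₀, rfl, -⟩ := hU
      have : (S : ℝ) ≤ S₀ := hm.trans hm₀.le
      gcongr
  exact ⟨U, ⟨hU, hmax⟩, fun u => ⟨hach u, hub u⟩, hach,
    fun v hv => hub (Classical.arbitrary ι) v (hv _)⟩

theorem mainTheorem2 {Ω : Type*} [MeasurableSpace Ω] (μ : Measure Ω) [IsProbabilityMeasure μ]
    (n m K B : ℕ) (hn : 0 < n) (hK : 0 < K)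
    (Δ σ : ℝ) (hΔ : 0 < Δ) (hσ : 0 < σ)
    (r : Fin m → ℝ) (hr : StrictMono r) (hr0 : ∀ k, 0 < r k)
    (p : Fin n → Fin m → ℝ)
    (R : Fin n → ℕ → Ω → ℝ)
    (hRmeas : ∀ i t, Measurable (R i t))
    (hRval : ∀ i t ω, R i t ω ∈ Set.range r)
    (hRp : ∀ i t k, μ.real {ω | R i t ω = r k} = p i k)
    (hRindep : iIndepFun (fun x : Fin n × ℕ => R x.1 x.2) μ)
    (ε δ₀ : ℝ) :
    -- the frame ratios are an allocation of the whole frame, and all users get the rate `C(t)`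
    (∀ t ω, (∀ i, 0 ≤ frameRatio R i t ω ∧ frameRatio R i t ω ≤ 1) ∧
      ∑ i, frameRatio R i t ω = 1) ∧
    (∀ i t ω, dataRate K (frameRatio R) R i t ω = commonRate K R t ω) ∧
    -- distribution of `C(t)`
    (∀ t, (∀ x, 0 < x → μ.real {ω | commonRate K R t ω = x} = ratePMF K r p x) ∧
      ∀ x ≤ 0, μ.real {ω | commonRate K R t ω = x} = 0) ∧
    -- distribution of the arrivals
    (∀ t, ∀ i : ℕ, 0 < i →
      μ.real {ω | commonRate K R t ω * Δ / σ = i} = ratePMF K r p (σ / Δ * i) ∧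
      ratePMF K r p (σ / Δ * i) = exactArrivalPMF K Δ σ r p i) ∧
    (∀ u : Fin n, iIndepFun (userArrivals K Δ σ R u) μ ∧
      ∀ t, (∀ i : ℕ, μ.real {ω | userArrivals K Δ σ R u t ω = i} = arrivalPMF K Δ σ r p i) ∧
        HasSum (fun i : ℕ => (i : ℝ) * arrivalPMF K Δ σ r p i)
          (∫ ω, (userArrivals K Δ σ R u t ω : ℝ) ∂μ)) ∧
    ((∀ k : Fin n → Fin m, (∏ j, p j (k j)) ≠ 0 →
        ∃ N : ℕ, (K / ∑ j, 1 / r (k j)) * Δ / σ = N) →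
      arrivalPMF K Δ σ r p 0 = 0 ∧
      ∀ i : ℕ, 0 < i → arrivalPMF K Δ σ r p i = exactArrivalPMF K Δ σ r p i) ∧
    -- the playout rate; `0 < E[A]` makes the drop rate meaningful
    (0 < pmfMean (arrivalPMF K Δ σ r p) →
      (∀ S : ℕ, 0 < S → S < B → pmfMean (arrivalPMF K Δ σ r p) < S →
        ∃ qB q : ℕ → ℝ,
          (IsBufferStationary (arrivalPMF K Δ σ r p) B S qB ∧
            ∀ q', IsBufferStationary (arrivalPMF K Δ σ r p) B S q' → q' = qB) ∧
          (IsQueueStationary (arrivalPMF K Δ σ r p) S q ∧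
            ∀ q', IsQueueStationary (arrivalPMF K Δ σ r p) S q' → q' = q) ∧
          0 < 1 - ∑ i ∈ Finset.range S, (1 - (i : ℝ) / S) * q i ∧
          ∀ u : Fin n,
            (∀ i : ℕ, Tendsto
              (fun t => μ.real {ω | bufferQueue B S (userArrivals K Δ σ R u) t ω = i})
              atTop (𝓝 (qB i))) ∧
            (∀ i : ℕ, Tendsto
              (fun t => μ.real {ω | queue S (userArrivals K Δ σ R u) t ω = i})
              atTop (𝓝 (q i))) ∧
            HasOutage μ B S (userArrivals K Δ σ R u) (∑ i ∈ Finset.range S, qB i) ∧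
            HasDropRate μ B S (userArrivals K Δ σ R u) (dropFormula S qB q)) ∧
      ((formulaRates (arrivalPMF K Δ σ r p) B Δ σ ε δ₀).Nonempty →
        ∃ U : ℝ, IsGreatest (formulaRates (arrivalPMF K Δ σ r p) B Δ σ ε δ₀) U ∧
          (∀ u : Fin n,
            IsGreatest (achievableRates μ B Δ σ ε δ₀ (userArrivals K Δ σ R u)) U) ∧
          IsGreatest
            {v | ∀ u : Fin n, v ∈ achievableRates μ B Δ σ ε δ₀ (userArrivals K Δ σ R u)} U)) := by
  have hR : ∀ i t ω, 0 < R i t ω := fun i t ω => by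
    obtain ⟨k, hk⟩ := hRval i t ω; exact hk ▸ hr0 k
  have hK' : (0 : ℝ) < K := by exact_mod_cast hK
  have hs := fun t ω => sum_inv_pos hn fun j => hR j t ω
  have hC : ∀ t ω, 0 < commonRate K R t ω := fun t ω => div_pos hK' (hs t ω)
  have hevent := measureReal_rate_event hr hRmeas hRval hRp hRindep
  have hrate : ∀ t x, 0 < x → μ.real {ω | commonRate K R t ω = x} = ratePMF K r p x := by
    intro t x hx
    simp only [commonRate, div_eq_iff_div_sub_eq_zero (hs t _) hx]
    exact hevent t fun v => (K : ℝ) / x - ∑ j, 1 / v j = 0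
  have hA := fun u => iIndepFun_userArrivals (K := K) (Δ := Δ) (σ := σ) hR hRmeas hRindep u
  obtain ⟨N, hN⟩ := exists_userArrivals_lt (R := R) (K := K) (Δ := Δ) (σ := σ) hr0 hRval
  have hlaw : ∀ u t i, μ.real {ω | userArrivals K Δ σ R u t ω = i} = arrivalPMF K Δ σ r p i := by
    intro u t i
    simp only [userArrivals, arrivals, dataRate_frameRatio hR, commonRate]
    exact hevent t fun v => ⌊(K / ∑ j, 1 / v j) * Δ / σ⌋₊ = i
  have ha : IsFiniteLaw (arrivalPMF K Δ σ r p) N :=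
    isFiniteLaw_of_law ((hA ⟨0, hn⟩).1 0) (hN ⟨0, hn⟩ 0) (hlaw ⟨0, hn⟩ 0)
  -- One pair `qB`, `q` serves all users because their arrival laws agree.
  have hlong : 0 < pmfMean (arrivalPMF K Δ σ r p) → ∀ S : ℕ, 0 < S →
      pmfMean (arrivalPMF K Δ σ r p) < S →
      ∃ qB q : ℕ → ℝ,
        (IsBufferStationary (arrivalPMF K Δ σ r p) B S qB ∧
          ∀ q', IsBufferStationary (arrivalPMF K Δ σ r p) B S q' → q' = qB) ∧
        (IsQueueStationary (arrivalPMF K Δ σ r p) S q ∧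
          ∀ q', IsQueueStationary (arrivalPMF K Δ σ r p) S q' → q' = q) ∧
        ∀ u, HasLongRun μ B S (userArrivals K Δ σ R u) qB q := by
    intro h0 S hS hm
    obtain ⟨qB, hqB, huB⟩ := exists_unique_isBufferStationary ha B hm
    obtain ⟨q, hq, hu⟩ := exists_unique_isQueueStationary ha hm
    exact ⟨qB, q, ⟨hqB, huB⟩, ⟨hq, hu⟩, fun u =>
      hasLongRun hS h0 hm (hA u).1 (hA u).2 (hN u) (hlaw u) hqB hq⟩
  refine ⟨fun t ω => ?_, dataRate_frameRatio hR, fun t => ⟨hrate t, fun x hx => ?_⟩,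
    fun t i hi => ⟨?_, ratePMF_eq_exactArrivalPMF i⟩, fun u => ⟨(hA u).2, fun t => ⟨hlaw u t, ?_⟩⟩,
    arrivalPMF_of_integral hn hK hΔ hσ hr0, fun h0 => ⟨fun S hS _ hm => ?_, fun hne => ?_⟩⟩
  · have hsum : ∑ i, frameRatio R i t ω = 1 := by
      simp only [frameRatio, ← Finset.sum_div]
      exact div_self (hs t ω).ne'
    have hnn : ∀ i, 0 ≤ frameRatio R i t ω := fun i =>
      div_nonneg (one_div_nonneg.2 (hR i t ω).le) (hs t ω).le
    exact ⟨fun i => ⟨hnn i, hsum ▸ Finset.single_le_sum (f := fun i => frameRatio R i t ω)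
      (fun j _ => hnn j) (Finset.mem_univ i)⟩, hsum⟩
  · have : {ω | commonRate K R t ω = x} = ∅ :=
      Set.eq_empty_of_forall_notMem fun ω h => absurd (hC t ω) (by rw [h]; exact hx.not_gt)
    rw [this, measureReal_empty]
  · have hi' : (0 : ℝ) < i := by exact_mod_cast hi
    rw [← hrate t _ (by positivity)]
    congr 1
    ext ω
    simp only [Set.mem_ofPred_eq]
    rw [div_eq_iff hσ.ne', div_mul_eq_mul_div, eq_div_iff hΔ.ne', mul_comm (i : ℝ)]
  · rw [integral_cast_eq_mean ((hA u).1 t) (hN u t) (hlaw u t)]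
    refine hasSum_sum_of_ne_finset_zero fun l hl => ?_
    rw [ha.zero_of_le l (by simpa using hl), mul_zero]
  · obtain ⟨qB, q, hqB, hq, hlim⟩ := hlong h0 S hS hm
    refine ⟨qB, q, hqB, hq, ?_, fun u =>
      ⟨(hlim u).buffer, (hlim u).queue, (hlim u).outage, (hlim u).dropRate⟩⟩
    -- The denominator equals `E[A] / S`.
    rw [one_sub_sum_eq ha hS hm hq.1]
    positivity
  · have : Nonempty (Fin n) := ⟨⟨0, hn⟩⟩
    refine exists_isGreatest_rates hΔ hσ (fun S hS _ hm => ?_) hne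
    obtain ⟨qB, q, hqB, hq, hlim⟩ := hlong h0 S hS hm
    exact ⟨qB, q, hqB, hq, fun u => ⟨(hlim u).outage, (hlim u).dropRate⟩⟩
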